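/- **Setting.** Let $g:\mathbb R^d\to\mathbb R^d$, $h(x)=x-g(x)$, and let $x^*$ satisfy $h(x^*)=0$; assume $h$ is Lipschitz continuously differentiable in a neighbourhood of $x^*$ and $y^{\mathrm T}h'(x^*)y>0$ for all $y\ne0$. Let $\hat\rho,\hat\kappa,\mu,L>0$ be constants such that $h$ is differentiable on $\|x-x^*\|_2\le\hat\rho$ and, for all such $x$ and all $y\in\mathbb R^d$, $\mu\|y\|_2\le\|h'(x)y\|_2\le L\|y\|_2$, $\ \mu\|y\|_2^2\le y^{\mathrm T}h'(x)y\le L\|y\|_2^2$, and $\|h(x)-h'(x^*)(x-x^*)\|_2\le\frac12\hat\kappa\|x-x^*\|_2^2$ (such constants exist). **Process I (restarted Anderson mixing).** Fix an integer $m\ge1$, $\tau\in(0,1)$, $\eta>0$, and mixing parameters with $\beta\le|\beta_k|\le\beta'$ for constants $\beta,\beta'>0$. Let $r_k=g(x_k)-x_k$, and $v_j=p_j$ (Type-I) or $v_j=q_j$ (Type-II). Start with $x_0$ and $m_0=0$. At iteration $k$, with $P_k=(p_{k-m_k+1},\dots,p_k)$, $Q_k=(q_{k-m_k+1},\dots,q_k)$,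 $V_k=(v_{k-m_k+1},\dots,v_k)$, set $$x_{k+1}=x_k-P_k\Gamma_k+\beta_k(r_k-Q_k\Gamma_k),\qquad r_k-Q_k\Gamma_k\perp\operatorname{range}V_k,$$ $$p_{k+1}=x_{k+1}-x_k-P_k\zeta_{k+1},\quad q_{k+1}=r_{k+1}-r_k-Q_k\zeta_{k+1},\qquad q_{k+1}\perp\operatorname{range}V_k,$$ where $\Gamma_k,\zeta_{k+1}\in\mathbb R^{m_k}$ are computed sequentially (modified Gram–Schmidt), and terms with $P_k,Q_k$ are absent if $m_k=0$. Put $m_{k+1}=m_k+1$ if $m_k+1\le m$, $\|r_{k+1}\|_2\le\eta\|r_{k-m_k}\|_2$ and $|v_{k+1}^{\mathrm T}q_{k+1}|\ge\tau|v_{k-m_k+1}^{\mathrm T}q_{k-m_k+1}|$ (in the last inequality $k-m_k+1$ is the first index of the current cycle); otherwise restart: $m_{k+1}=0$. **Process II.** With the same $m_k,\beta_k$ and type, run the same recursion (hatted quantities) with $\hat r_k=-h'(x^*)(\hat x_k-x^*)$ in place of $r_k$, resetting $\hat x_k=x_k$ whenever $m_k=0$. **Hessenberg matrices.** Suppose $m_{k+1}\ge2$.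 With $\phi_j=\Gamma_j+\zeta_{j+1}$, define along the current cycle $H_k\in\mathbb R^{m_k\times m_k}$ and $\bar H_k=\begin{pmatrix}H_k\\ h_k^{(m_k+1)}e_{m_k}^{\mathrm T}\end{pmatrix}$ by $H_k=h_k$ if $m_k=1$, $H_k=(\bar H_{k-1},h_k)$ if $m_k\ge2$, where $h_k^{(m_k+1)}=-\frac1{\beta_k(1-\Gamma_k^{(m_k)})}$, and $$h_k=\frac1{1-\Gamma_k}\Bigl(\frac1{\beta_{k-1}}-\frac{1}{\beta_k}\phi_k\Bigr)\ (m_k=1),$$ $$h_k=\frac1{1-\Gamma_k^{(m_k)}}\Bigl(\frac1{\beta_{k-1}}\begin{pmatrix}\phi_{k-1}\\1\end{pmatrix}-\frac1{\beta_k}\phi_k-\bar H_{k-1}\bigl(\phi_{k-1}-(\Gamma_k^{(1)},\dots,\Gamma_k^{(m_k-1)})^{\mathrm T}\bigr)\Bigr)\ (m_k\ge2).$$ Let $\hat H_k$ be the matrix obtained in the same way from $\hat\Gamma_j,\hat\zeta_{j+1}$. **Theorem.** Let $\eta_0,\tau_0>0$. There is a constant $C>0$, depending only on the type, $d,m,\tau,\eta,\eta_0,\tau_0,\beta,\beta',\mu,L$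 (in particular not on $g$, $\hat\kappa$, $k$ or $x_0$), such that for every $g,x^*,\hat\rho,\hat\kappa$ as above there is $\delta>0$ with the following property. Let $\|x_0-x^*\|_2\le\delta$, let $(\beta_j)$ be any sequence with $\beta\le|\beta_j|\le\beta'$, and let $k$ be such that $m_{k+1}\ge2$, $r_j\ne0$ for $j\le k$ (the method has not terminated), $\|h(x_j)\|_2\le\eta_0\|h(x_0)\|_2$ for $0\le j\le k+1$, and $|1-\Gamma_j^{(m_j)}|\ge\tau_0$ for all $1\le j\le k$ with $m_j\ge1$. Then for every $j\le k$ the matrices $V_j^{\mathrm T}Q_j$ and $\hat V_j^{\mathrm T}\hat Q_j$ are nonsingular, the orthogonality conditions above hold in both processes, and $\Gamma_j^{(m_j)}\ne1\ne\hat\Gamma_j^{(m_j)}$ if $m_j\ge1$ (so $H_k,\hat H_k$ are well defined); and for every eigenvalue $\lambda\in\mathbb C$ of $H_k$, $$\min_{\hat\lambda\in\sigma(\hat H_k)}|\hat\lambda-\lambda|\le C\,\hat\kappa^{1/m_k}\,\|x_{k-m_k}-x^*\|_2^{1/m_k}.$$ If moreover $\hat H_k=M_k\hat D_kM_k^{-1}$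 with $M_k$ nonsingular and $\hat D_k$ diagonal (real or complex), then $$\min_{\hat\lambda\in\sigma(\hat H_k)}|\hat\lambda-\lambda|\le C\,\|M_k\|_2\|M_k^{-1}\|_2\,\hat\kappa\,\|x_{k-m_k}-x^*\|_2 .$$ -/

import Mathlib

open scoped Topology NNReal InnerProductSpace Matrix

noncomputable section

namespace RestartedAM

/-- The two variants of Anderson mixing. -/
inductive AMType where
  | typeI
  | typeII

variable {d : ℕ}

/-- The vector `v_j` belonging to a pair `(p_j, q_j)`: `v_j = p_j` for Type-I and `v_j = q_j` for
Type-II. -/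
def AMType.v (ty : AMType) (p q : EuclideanSpace ℝ (Fin d)) : EuclideanSpace ℝ (Fin d) :=
  match ty with
  | .typeI => p
  | .typeII => q

/-! ### The fixed-point problem and its linearization -/

/-- `h(x) = x - g(x)`. -/
def hMap (g : EuclideanSpace ℝ (Fin d) → EuclideanSpace ℝ (Fin d))
    (x : EuclideanSpace ℝ (Fin d)) : EuclideanSpace ℝ (Fin d) := x - g x

/-- The residual `r = g(x) - x = -h(x)`. -/
def residual (g : EuclideanSpace ℝ (Fin d) → EuclideanSpace ℝ (Fin d))
    (x : EuclideanSpace ℝ (Fin d)) : EuclideanSpace ℝ (Fin d) := g x - x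

/-- The residual `-h'(x*)(x - x*)` of the linearized problem at `x*`. -/
def linResidual (g : EuclideanSpace ℝ (Fin d) → EuclideanSpace ℝ (Fin d))
    (xs x : EuclideanSpace ℝ (Fin d)) : EuclideanSpace ℝ (Fin d) :=
  -(fderiv ℝ (hMap g) xs (x - xs))

/-- The standing assumption: `h(x*) = 0`, `h` is Lipschitz continuously differentiable in a
neighbourhood of `x*`, and `h'(x*)` is positive definite (its symmetric part is). -/
structure StandingAssumption (g : EuclideanSpace ℝ (Fin d) → EuclideanSpace ℝ (Fin d))
    (xs : EuclideanSpace ℝ (Fin d)) : Prop where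
  root : hMap g xs = 0
  smooth : ∃ U ∈ 𝓝 xs, ∃ K : ℝ≥0, (∀ x ∈ U, DifferentiableAt ℝ (hMap g) x) ∧
    LipschitzOnWith K (fderiv ℝ (hMap g)) U
  posDef : ∀ y : EuclideanSpace ℝ (Fin d), y ≠ 0 → 0 < ⟪y, fderiv ℝ (hMap g) xs y⟫_ℝ

/-- `ρ, κ, μ, L` are admissible constants for `h` at `x*`: positive numbers for which the usual
two-sided bounds on `h'` and the second-order bound on `h(x) - h'(x*)(x - x*)` hold on the closed
ball of radius `ρ` about `x*`. -/
structure LocalConstants (g : EuclideanSpace ℝ (Fin d) → EuclideanSpace ℝ (Fin d))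
    (xs : EuclideanSpace ℝ (Fin d)) (ρ κ μ L : ℝ) : Prop where
  ρ_pos : 0 < ρ
  κ_pos : 0 < κ
  μ_pos : 0 < μ
  L_pos : 0 < L
  differentiable : ∀ x ∈ Metric.closedBall xs ρ, DifferentiableAt ℝ (hMap g) x
  jacobian : ∀ x ∈ Metric.closedBall xs ρ, ∀ y : EuclideanSpace ℝ (Fin d),
    μ * ‖y‖ ≤ ‖fderiv ℝ (hMap g) x y‖ ∧ ‖fderiv ℝ (hMap g) x y‖ ≤ L * ‖y‖
  symmetricPart : ∀ x ∈ Metric.closedBall xs ρ, ∀ y : EuclideanSpace ℝ (Fin d),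
    μ * ‖y‖ ^ 2 ≤ ⟪y, fderiv ℝ (hMap g) x y⟫_ℝ ∧
      ⟪y, fderiv ℝ (hMap g) x y⟫_ℝ ≤ L * ‖y‖ ^ 2
  taylor : ∀ x ∈ Metric.closedBall xs ρ,
    ‖hMap g x - fderiv ℝ (hMap g) xs (x - xs)‖ ≤ 1 / 2 * κ * ‖x - xs‖ ^ 2

/-- Under the standing assumption admissible constants exist. -/
theorem StandingAssumption.exists_localConstants
    {g : EuclideanSpace ℝ (Fin d) → EuclideanSpace ℝ (Fin d)} {xs : EuclideanSpace ℝ (Fin d)}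
    (hg : StandingAssumption g xs) : ∃ ρ κ μ L : ℝ, LocalConstants g xs ρ κ μ L := by
  obtain ⟨U, hU, K, hdiff, hlip⟩ := hg.smooth
  set A := fderiv ℝ (hMap g) xs with hA
  obtain ⟨μ₀, hμ₀, hμ⟩ : ∃ μ₀ : ℝ, 0 < μ₀ ∧
      ∀ y : EuclideanSpace ℝ (Fin d), μ₀ * ‖y‖ ^ 2 ≤ ⟪y, A y⟫_ℝ := by
    rcases (Metric.sphere (0 : EuclideanSpace ℝ (Fin d)) 1).eq_empty_or_nonempty with he | hne
    · refine ⟨1, one_pos, fun y => ?_⟩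
      by_cases hy : y = 0
      · simp [hy]
      · exfalso
        have : (‖y‖⁻¹ • y) ∈ Metric.sphere (0 : EuclideanSpace ℝ (Fin d)) 1 := by
          simp [norm_smul, hy]
        rw [he] at this
        exact this
    · obtain ⟨z, hz, hmin⟩ := (isCompact_sphere (0 : EuclideanSpace ℝ (Fin d)) 1).exists_isMinOn hne
        (f := fun y => ⟪y, A y⟫_ℝ) (by fun_prop)
      have hz0 : z ≠ 0 := by
        rintro rfl
        simp at hz
      refine ⟨⟪z, A z⟫_ℝ, hg.posDef z hz0, fun y => ?_⟩
      by_cases hy : y = 0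
      · simp [hy]
      · have hmem : (‖y‖⁻¹ • y) ∈ Metric.sphere (0 : EuclideanSpace ℝ (Fin d)) 1 := by
          simp [norm_smul, hy]
        have h1 : ⟪z, A z⟫_ℝ ≤ ⟪‖y‖⁻¹ • y, A (‖y‖⁻¹ • y)⟫_ℝ := hmin hmem
        rw [map_smul, inner_smul_left, inner_smul_right] at h1
        have hy' : 0 < ‖y‖ := norm_pos_iff.mpr hy
        have h2 : ⟪z, A z⟫_ℝ * ‖y‖ ^ 2 ≤
            (‖y‖⁻¹ * (‖y‖⁻¹ * ⟪y, A y⟫_ℝ)) * ‖y‖ ^ 2 :=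
          mul_le_mul_of_nonneg_right (by simpa using h1) (by positivity)
        have h3 : (‖y‖⁻¹ * (‖y‖⁻¹ * ⟪y, A y⟫_ℝ)) * ‖y‖ ^ 2 = ⟪y, A y⟫_ℝ := by
          field_simp
        linarith
  obtain ⟨ρ₁, hρ₁, hball⟩ := Metric.nhds_basis_closedBall.mem_iff.mp hU
  have hK : (0 : ℝ) ≤ K := K.2
  set ρ := min ρ₁ (μ₀ / (2 * (K + 1))) with hρ
  have hρpos : 0 < ρ := lt_min hρ₁ (by positivity)
  have hsub : Metric.closedBall xs ρ ⊆ U :=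
    (Metric.closedBall_subset_closedBall (min_le_left _ _)).trans hball
  have hxs : xs ∈ U := hsub (Metric.mem_closedBall_self hρpos.le)
  have hclose : ∀ x ∈ Metric.closedBall xs ρ,
      ‖fderiv ℝ (hMap g) x - A‖ ≤ K * ‖x - xs‖ := fun x hx => by
    have := hlip.dist_le_mul x (hsub hx) xs hxs
    rwa [dist_eq_norm, dist_eq_norm] at this
  have hhalf : ∀ x ∈ Metric.closedBall xs ρ, ‖fderiv ℝ (hMap g) x - A‖ ≤ μ₀ / 2 := fun x hx => by
    have h1 : ‖x - xs‖ ≤ μ₀ / (2 * (K + 1)) := by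
      have := Metric.mem_closedBall.mp hx
      rw [dist_eq_norm] at this
      exact this.trans (min_le_right _ _)
    calc _ ≤ K * ‖x - xs‖ := hclose x hx
      _ ≤ (K + 1) * (μ₀ / (2 * (K + 1))) := by gcongr; linarith
      _ = μ₀ / 2 := by field_simp
  have hlow : ∀ x ∈ Metric.closedBall xs ρ, ∀ y : EuclideanSpace ℝ (Fin d),
      μ₀ / 2 * ‖y‖ ^ 2 ≤ ⟪y, fderiv ℝ (hMap g) x y⟫_ℝ := fun x hx y => by
    have h1 : ⟪y, fderiv ℝ (hMap g) x y⟫_ℝ = ⟪y, A y⟫_ℝ +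
        ⟪y, (fderiv ℝ (hMap g) x - A) y⟫_ℝ := by
      rw [← inner_add_right]
      simp
    have h2 : |⟪y, (fderiv ℝ (hMap g) x - A) y⟫_ℝ| ≤ ‖y‖ * (μ₀ / 2 * ‖y‖) :=
      (abs_real_inner_le_norm _ _).trans (mul_le_mul_of_nonneg_left
        (((fderiv ℝ (hMap g) x - A).le_opNorm y).trans
          (mul_le_mul_of_nonneg_right (hhalf x hx) (norm_nonneg _))) (norm_nonneg _))
    have h3 := (abs_le.mp h2).1
    have h4 := hμ y
    nlinarith
  have hup : ∀ x ∈ Metric.closedBall xs ρ, ∀ y : EuclideanSpace ℝ (Fin d),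
      ‖fderiv ℝ (hMap g) x y‖ ≤ (‖A‖ + μ₀ / 2) * ‖y‖ := fun x hx y => by
    refine ((fderiv ℝ (hMap g) x).le_opNorm y).trans
      (mul_le_mul_of_nonneg_right ?_ (norm_nonneg _))
    have h1 : fderiv ℝ (hMap g) x = A + (fderiv ℝ (hMap g) x - A) := by abel
    rw [h1]
    exact (norm_add_le _ _).trans (by gcongr; exact hhalf x hx)
  refine ⟨ρ, 2 * (K + 1), μ₀ / 2, ‖A‖ + μ₀ / 2, hρpos, by positivity, by positivity, by positivity,
    fun x hx => hdiff x (hsub hx), fun x hx y => ⟨?_, hup x hx y⟩,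
    fun x hx y => ⟨hlow x hx y, ?_⟩, fun x hx => ?_⟩
  · by_cases hy : y = 0
    · simp [hy]
    · have hy' : 0 < ‖y‖ := norm_pos_iff.mpr hy
      have h1 := (hlow x hx y).trans (real_inner_le_norm _ _)
      have h2 : ‖y‖ * (μ₀ / 2 * ‖y‖) ≤ ‖y‖ * ‖fderiv ℝ (hMap g) x y‖ := by
        linarith [h1, sq ‖y‖]
      exact le_of_mul_le_mul_left h2 hy'
  · refine (real_inner_le_norm _ _).trans ?_
    nlinarith [hup x hx y, norm_nonneg y]
  · have hr : ‖x - xs‖ ≤ ρ := by simpa [dist_eq_norm] using hx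
    have hss : Metric.closedBall xs ‖x - xs‖ ⊆ Metric.closedBall xs ρ :=
      Metric.closedBall_subset_closedBall hr
    have h1 := (convex_closedBall xs ‖x - xs‖).norm_image_sub_le_of_norm_fderiv_le'
      (𝕜 := ℝ) (f := hMap g) (φ := A) (C := K * ‖x - xs‖) (x := xs) (y := x)
      (fun z hz => hdiff z (hsub (hss hz)))
      (fun z hz => (hclose z (hss hz)).trans (by
        have : ‖z - xs‖ ≤ ‖x - xs‖ := by simpa [dist_eq_norm] using hz
        gcongr))
      (by simp) (by simp [dist_eq_norm])
    rw [hg.root, sub_zero] at h1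
    nlinarith [sq_nonneg ‖x - xs‖]

/-! ### Anderson mixing with modified historical sequences -/

/-- The sequential orthogonalization `u^0 = u`,
`u^{j+1} = u^j - q_j (v_jᵀ u^j) / (v_jᵀ q_j)`. -/
def sweep (v q : ℕ → EuclideanSpace ℝ (Fin d)) (u : EuclideanSpace ℝ (Fin d)) :
    ℕ → EuclideanSpace ℝ (Fin d)
  | 0 => u
  | j + 1 => sweep v q u j - (⟪v j, sweep v q u j⟫_ℝ / ⟪v j, q j⟫_ℝ) • q j

/-- The coefficient `(v_jᵀ u^j) / (v_jᵀ q_j)` of `sweep`. -/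
def sweepCoeff (v q : ℕ → EuclideanSpace ℝ (Fin d)) (u : EuclideanSpace ℝ (Fin d)) (j : ℕ) : ℝ :=
  ⟪v j, sweep v q u j⟫_ℝ / ⟪v j, q j⟫_ℝ

/-- The data held at iteration `k`: the iterate `x = x_k`, the iterate `base = x_{k-m_k}` at which
the current cycle started, the memory `m = m_k`, and the modified historical vectors
`p j = p_{k-m_k+1+j}`, `q j = q_{k-m_k+1+j}` for `j < m_k` (other values of `p`, `q` are unused).
All lists are indexed from `0`. -/
structure State (d : ℕ) where
  x : EuclideanSpace ℝ (Fin d)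
  base : EuclideanSpace ℝ (Fin d)
  m : ℕ
  p : ℕ → EuclideanSpace ℝ (Fin d)
  q : ℕ → EuclideanSpace ℝ (Fin d)

namespace State

/-- The state at `x` with empty history. -/
def restart (x : EuclideanSpace ℝ (Fin d)) : State d := ⟨x, x, 0, fun _ => 0, fun _ => 0⟩

variable (ty : AMType) (res : EuclideanSpace ℝ (Fin d) → EuclideanSpace ℝ (Fin d))

/-- `v j = v_{k-m_k+1+j}`. -/
def v (S : State d) (j : ℕ) : EuclideanSpace ℝ (Fin d) := ty.v (S.p j) (S.q j)

/-- `gamma j` is the coefficient of index `j + 1` of `Γ_k` (for `j < m_k`). -/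
def gamma (S : State d) (j : ℕ) : ℝ := sweepCoeff (S.v ty) S.q (res S.x) j

/-- `r̄_k = r_k - Q_k Γ_k`. -/
def rBar (S : State d) : EuclideanSpace ℝ (Fin d) := sweep (S.v ty) S.q (res S.x) S.m

/-- `x̄_k = x_k - P_k Γ_k`. -/
def xBar (S : State d) : EuclideanSpace ℝ (Fin d) :=
  S.x - ∑ j ∈ Finset.range S.m, S.gamma ty res j • S.p j

/-- `x_{k+1} = x̄_k + β_k r̄_k`. -/
def xNext (β : ℝ) (S : State d) : EuclideanSpace ℝ (Fin d) :=
  S.xBar ty res + β • S.rBar ty res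

/-- `zeta j` is the coefficient of index `j + 1` of `ζ_{k+1}` (for `j < m_k`). -/
def zeta (β : ℝ) (S : State d) (j : ℕ) : ℝ :=
  sweepCoeff (S.v ty) S.q (res (S.xNext ty res β) - res S.x) j

/-- `p_{k+1} = Δx_k - P_k ζ_{k+1}`. -/
def pNext (β : ℝ) (S : State d) : EuclideanSpace ℝ (Fin d) :=
  (S.xNext ty res β - S.x) - ∑ j ∈ Finset.range S.m, S.zeta ty res β j • S.p j

/-- `q_{k+1} = Δr_k - Q_k ζ_{k+1}`. -/
def qNext (β : ℝ) (S : State d) : EuclideanSpace ℝ (Fin d) :=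
  sweep (S.v ty) S.q (res (S.xNext ty res β) - res S.x) S.m

/-- The state at iteration `k + 1` if no restart takes place. -/
def extend (β : ℝ) (S : State d) : State d where
  x := S.xNext ty res β
  base := S.base
  m := S.m + 1
  p := Function.update S.p S.m (S.pNext ty res β)
  q := Function.update S.q S.m (S.qNext ty res β)

/-- The conditions under which no restart takes place, for a state with `m_k ≥ 1`:
`m_k ≤ m`, `‖r_k‖ ≤ η ‖r_{k-m_k}‖` and `|v_kᵀ q_k| ≥ τ |v_{k-m_k+1}ᵀ q_{k-m_k+1}|`. -/
def Accept (m : ℕ) (τ η : ℝ) (S : State d) : Prop :=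
  S.m ≤ m ∧ ‖res S.x‖ ≤ η * ‖res S.base‖ ∧
    τ * |⟪S.v ty 0, S.q 0⟫_ℝ| ≤ |⟪S.v ty (S.m - 1), S.q (S.m - 1)⟫_ℝ|

/-- The projection steps at this iteration are well posed: `V_kᵀ Q_k` is nonsingular, `Γ_k` solves
`r_k - Q_k Γ_k ⊥ range V_k`, `ζ_{k+1}` solves `Δr_k - Q_k ζ_{k+1} ⊥ range V_k`, and the last
entry of `Γ_k` is not `1`. -/
def WellPosed (β : ℝ) (S : State d) : Prop :=
  (Matrix.of fun i j : Fin S.m => ⟪S.v ty i, S.q j⟫_ℝ).det ≠ 0 ∧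
  (∀ i < S.m,
    ⟪S.v ty i, res S.x - ∑ j ∈ Finset.range S.m, S.gamma ty res j • S.q j⟫_ℝ = 0) ∧
  (∀ i < S.m, ⟪S.v ty i, (res (S.xNext ty res β) - res S.x) -
    ∑ j ∈ Finset.range S.m, S.zeta ty res β j • S.q j⟫_ℝ = 0) ∧
  (0 < S.m → S.gamma ty res (S.m - 1) ≠ 1)

end State

open Classical in
/-- Process I: the restarted AM method with mixing parameters `β k` and restart parameters
`m, τ, η`, started at `x0`. -/
def process (ty : AMType) (g : EuclideanSpace ℝ (Fin d) → EuclideanSpace ℝ (Fin d))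
    (β : ℕ → ℝ) (m : ℕ) (τ η : ℝ) (x0 : EuclideanSpace ℝ (Fin d)) : ℕ → State d
  | 0 => State.restart x0
  | k + 1 =>
    if ((process ty g β m τ η x0 k).extend ty (residual g) (β k)).Accept ty (residual g) m τ η
    then (process ty g β m τ η x0 k).extend ty (residual g) (β k)
    else State.restart ((process ty g β m τ η x0 k).xNext ty (residual g) (β k))

/-- Process II: in each interval between two successive restarts of Process I, full-memory AM (with
the same `m_k` and `β_k`) for the linearized problem, started at the iterate of Process I at which
the interval begins. -/
def linProcess (ty : AMType) (g : EuclideanSpace ℝ (Fin d) → EuclideanSpace ℝ (Fin d))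
    (xs : EuclideanSpace ℝ (Fin d)) (β : ℕ → ℝ) (m : ℕ) (τ η : ℝ)
    (x0 : EuclideanSpace ℝ (Fin d)) : ℕ → State d
  | 0 => State.restart x0
  | k + 1 =>
    if (process ty g β m τ η x0 (k + 1)).m = 0
    then State.restart (process ty g β m τ η x0 (k + 1)).x
    else (linProcess ty g xs β m τ η x0 k).extend ty (linResidual g xs) (β k)

/-! ### The Hessenberg matrix -/

/-- The `(n+1) × n` upper Hessenberg matrix `H̄_k` for the iteration `k = s + n` of a cycle that
started at iteration `s` (so that `m_k = n`), built from `β`, `Γ` and `φ_k = Γ_k + ζ_{k+1}`, with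
`Γ k i` and `φ k i` the entries of index `i + 1`.  Its last column is `h_k` followed by
`h_k^{(m_k+1)}`, its other columns are those of `H̄_{k-1}` extended by `0`. -/
def hessBar (β : ℕ → ℝ) (Γ φ : ℕ → ℕ → ℝ) (s : ℕ) : (n : ℕ) → Matrix (Fin (n + 1)) (Fin n) ℝ
  | 0 => 0
  | n + 1 =>
    let h : Fin (n + 1) → ℝ := (1 / (1 - Γ (s + n + 1) n)) •
      ((1 / β (s + n)) • (Fin.snoc (fun i : Fin n => φ (s + n) i) 1 : Fin (n + 1) → ℝ)
        - (1 / β (s + n + 1)) • (fun i : Fin (n + 1) => φ (s + n + 1) i)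
        - hessBar β Γ φ s n *ᵥ (fun i : Fin n => φ (s + n) i - Γ (s + n + 1) i))
    let hSub : ℝ := -(1 / (β (s + n + 1) * (1 - Γ (s + n + 1) n)))
    Matrix.of fun (i : Fin (n + 2)) (j : Fin (n + 1)) =>
      (Fin.snoc (fun j' : Fin n => (Fin.snoc (fun i' : Fin (n + 1) => hessBar β Γ φ s n i' j') 0 :
          Fin (n + 2) → ℝ) i)
        ((Fin.snoc h hSub : Fin (n + 2) → ℝ) i) : Fin (n + 1) → ℝ) j

/-- The `n × n` matrix `H_k` (with `n = m_k`) of a sequence of states `S`: `H̄_k` without its last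
row. -/
def hess (ty : AMType) (res : EuclideanSpace ℝ (Fin d) → EuclideanSpace ℝ (Fin d)) (β : ℕ → ℝ)
    (S : ℕ → State d) (k n : ℕ) : Matrix (Fin n) (Fin n) ℝ :=
  Matrix.of fun i j =>
    hessBar β (fun l => (S l).gamma ty res)
      (fun l i => (S l).gamma ty res i + (S l).zeta ty res (β l) i) (k - n) n i.castSucc j

/-- The complex spectrum of a real square matrix. -/
def cSpectrum {n : ℕ} (A : Matrix (Fin n) (Fin n) ℝ) : Set ℂ :=
  spectrum ℂ (A.map (fun t : ℝ => (t : ℂ)))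

/-- The spectral norm of a complex square matrix. -/
def specNorm {n : ℕ} (M : Matrix (Fin n) (Fin n) ℂ) : ℝ :=
  ‖Matrix.toEuclideanCLM (n := Fin n) (𝕜 := ℂ) M‖

end RestartedAM

end

/-! ### Sequential orthogonalization and the cycles of the two processes -/

noncomputable section

namespace RestartedAM

variable {d : ℕ}

/-! Within one cycle the two processes start at the same point and differ only through the Taylor
remainder of h at x*. Let e be the error at the start of the cycle and ε = κ̂e. While the iterates
stay within O(e) of x*, the remainder is O(κ̂e²) = O(εe), a relative perturbation of size ε. All
quantities of the recursion arise from boundedly many sums, products, inner products and quotients: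
vectors have size O(e), coefficients size O(1), and each carries a relative error O(ε). The relation
`Comparable` is stable under these operations; only division needs a lower bound on the denominator,
namely |v_jᵀq_j| ≳ e², |1 - Γ| ≥ τ₀ and |β_k| ≥ β. The first pair satisfies the bound because the
linear process has q = -Ap with p = β_k r̂ and A = h'(x*) positive definite, and closeness carries
this over to Process I; later pairs inherit it, up to τ, from the acceptance test
(`Cycle.stateComparable`). Hence the entries of H_k and Ĥ_k are O(1) and differ by O(ε)
(`Cycle.comparable_hessBar`).

Uniformity comes from the choice of filter. All O-estimates are taken along `Cycle.near`, a filter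
on the type of all cycles: the residual, x*, κ̂, ρ̂, the mixing parameters and the iterates are data
of a cycle, whereas d, the type of the method and the permitted constants are parameters of that
type. So the implied constants can depend on the parameters and the length only, and lengths are at
most m. The assumption ‖h(x_j)‖ ≤ η₀‖h(x₀)‖ keeps all cycles in the regime covered by the filter
(`norm_iterate_sub_le`).

For the eigenvalues, let λ be an eigenvalue of H_k. Then det(λ - Ĥ_k) = det(λ - Ĥ_k) - det(λ - H_k)
= O(ε), since the determinant is Lipschitz on bounded sets. It is also, in modulus, the product of
the m_k distances from λ to the eigenvalues of Ĥ_k, so one of these is O(ε^{1/m_k}). The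
diagonalizable case is `bauer_fike`. -/

theorem sweep_eq_sub_sum (v q : ℕ → EuclideanSpace ℝ (Fin d)) (u : EuclideanSpace ℝ (Fin d))
    (n : ℕ) : sweep v q u n = u - ∑ j ∈ Finset.range n, sweepCoeff v q u j • q j := by
  induction n with
  | zero => simp [sweep]
  | succ n ih =>
    rw [Finset.sum_range_succ, sweep, sweepCoeff, ← sub_sub, ← ih]

/-- Sequential orthogonalization is orthogonal to all previous `v i` if `Vᵀ Q` is lower
triangular with nonzero diagonal. -/
theorem inner_sweep_eq_zero {v q : ℕ → EuclideanSpace ℝ (Fin d)} {m : ℕ}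
    (htri : ∀ i j, i < j → j < m → ⟪v i, q j⟫_ℝ = 0) (hdiag : ∀ i < m, ⟪v i, q i⟫_ℝ ≠ 0)
    (u : EuclideanSpace ℝ (Fin d)) {n : ℕ} (hn : n ≤ m) {i : ℕ} (hi : i < n) :
    ⟪v i, sweep v q u n⟫_ℝ = 0 := by
  induction n with
  | zero => omega
  | succ n ih =>
    rw [sweep, inner_sub_right, inner_smul_right]
    rcases Nat.lt_succ_iff_lt_or_eq.mp hi with h | rfl
    · rw [ih (by omega) h, htri i n h (by omega)]
      simp
    · rw [div_mul_cancel₀ _ (hdiag i (by omega)), sub_self]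

namespace State

/-- The matrix `Vᵀ Q` of the state is lower triangular. -/
def LowerTriangular (ty : AMType) (S : State d) : Prop :=
  ∀ i j, i < j → j < S.m → ⟪S.v ty i, S.q j⟫_ℝ = 0

variable {ty : AMType} {res : EuclideanSpace ℝ (Fin d) → EuclideanSpace ℝ (Fin d)}

@[simp] theorem extend_m (β : ℝ) (S : State d) : (S.extend ty res β).m = S.m + 1 := rfl

theorem extend_p_of_lt (β : ℝ) (S : State d) {j : ℕ} (hj : j < S.m) :
    (S.extend ty res β).p j = S.p j := by
  simp [extend, Function.update_of_ne hj.ne]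

theorem extend_q_of_lt (β : ℝ) (S : State d) {j : ℕ} (hj : j < S.m) :
    (S.extend ty res β).q j = S.q j := by
  simp [extend, Function.update_of_ne hj.ne]

theorem extend_v_of_lt (β : ℝ) (S : State d) {j : ℕ} (hj : j < S.m) :
    (S.extend ty res β).v ty j = S.v ty j := by
  simp [v, extend_p_of_lt β S hj, extend_q_of_lt β S hj]

theorem extend_p_self (β : ℝ) (S : State d) :
    (S.extend ty res β).p S.m = S.pNext ty res β := by
  simp [extend]

theorem extend_q_self (β : ℝ) (S : State d) :
    (S.extend ty res β).q S.m = S.qNext ty res β := by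
  simp [extend]

theorem extend_v_self (β : ℝ) (S : State d) :
    (S.extend ty res β).v ty S.m = ty.v (S.pNext ty res β) (S.qNext ty res β) := by
  rw [v, extend_p_self, extend_q_self]

theorem lowerTriangular_restart (x : EuclideanSpace ℝ (Fin d)) :
    (restart x).LowerTriangular ty := fun _ _ _ hj => absurd hj (Nat.not_lt_zero _)

theorem LowerTriangular.extend {S : State d} (h : S.LowerTriangular ty)
    (hdiag : ∀ i < S.m, ⟪S.v ty i, S.q i⟫_ℝ ≠ 0) (β : ℝ) :
    (S.extend ty res β).LowerTriangular ty := by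
  intro i j hij hj
  rcases Nat.lt_succ_iff_lt_or_eq.mp hj with hlt | rfl
  · rw [extend_v_of_lt β S (hij.trans hlt), extend_q_of_lt β S hlt]
    exact h i j hij hlt
  · rw [extend_v_of_lt β S hij, extend_q_self]
    exact inner_sweep_eq_zero h hdiag _ le_rfl hij

/-- For a triangular VᵀQ the determinant is the product of the v_iᵀq_i, and the sequentially
computed coefficients solve all orthogonality conditions at once. -/
theorem LowerTriangular.wellPosed {S : State d} (h : S.LowerTriangular ty)
    (hdiag : ∀ i < S.m, ⟪S.v ty i, S.q i⟫_ℝ ≠ 0)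
    (hgamma : 0 < S.m → S.gamma ty res (S.m - 1) ≠ 1) (β : ℝ) : S.WellPosed ty res β := by
  refine ⟨?_, fun i hi => ?_, fun i hi => ?_, hgamma⟩
  · rw [Matrix.det_of_isLowerTriangular]
    · exact Finset.prod_ne_zero_iff.mpr fun i _ => hdiag i i.2
    · intro i j hij
      exact h i j hij j.2
  · have := inner_sweep_eq_zero h hdiag (res S.x) le_rfl hi
    rwa [sweep_eq_sub_sum] at this
  · have := inner_sweep_eq_zero h hdiag (res (S.xNext ty res β) - res S.x) le_rfl hi
    rwa [sweep_eq_sub_sum] at this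

/-- Nondegeneracy is asked of the final state only: extending a state leaves its earlier pairs
unchanged, so the same diagonal entries serve all preceding states. -/
theorem lowerTriangular_of_extend {S : ℕ → State d} {b : ℕ → ℝ} {s n : ℕ}
    {x : EuclideanSpace ℝ (Fin d)} (h0 : S s = restart x)
    (hext : ∀ i < n, S (s + i + 1) = (S (s + i)).extend ty res (b (s + i)))
    (hdiag : ∀ i < n, ⟪(S (s + n)).v ty i, (S (s + n)).q i⟫_ℝ ≠ 0) :
    (S (s + n)).LowerTriangular ty := by
  have hm : ∀ i ≤ n, (S (s + i)).m = i := by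
    intro i hi
    induction i with
    | zero => rw [add_zero, h0]; rfl
    | succ i ih => rw [← add_assoc, hext i hi, extend_m, ih (by omega)]
  induction n with
  | zero =>
    rw [add_zero, h0]
    exact lowerTriangular_restart x
  | succ n ih =>
    have hmn := hm n (by omega)
    rw [← add_assoc, hext n (by omega)] at hdiag ⊢
    have hdiag' : ∀ i < n, ⟪(S (s + n)).v ty i, (S (s + n)).q i⟫_ℝ ≠ 0 := fun i hi => by
      have := hdiag i (by omega)
      rwa [extend_v_of_lt _ _ (by omega), extend_q_of_lt _ _ (by omega)] at this
    exact (ih (fun i hi => hext i (by omega)) hdiag' fun i hi => hm i (by omega)).extend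
      (fun i hi => hdiag' i (by omega)) _

end State

/-- Iterations `s, …, s + n` belong to one cycle of Process I, and Process II runs along. -/
structure IsCycle (ty : AMType) (res lin : EuclideanSpace ℝ (Fin d) → EuclideanSpace ℝ (Fin d))
    (b : ℕ → ℝ) (m : ℕ) (τ η : ℝ) (S T : ℕ → State d) (s n : ℕ) : Prop where
  startS : S s = State.restart (S s).x
  startT : T s = State.restart (S s).x
  extendS : ∀ i < n, S (s + i + 1) = (S (s + i)).extend ty res (b (s + i))
  extendT : ∀ i < n, T (s + i + 1) = (T (s + i)).extend ty lin (b (s + i))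
  accept : ∀ i < n, (S (s + i + 1)).Accept ty res m τ η

/-- Every iteration belongs to a cycle, which starts `m_j` iterations before. -/
theorem exists_isCycle (ty : AMType) (g : EuclideanSpace ℝ (Fin d) → EuclideanSpace ℝ (Fin d))
    (xs : EuclideanSpace ℝ (Fin d)) (b : ℕ → ℝ) (m : ℕ) (τ η : ℝ)
    (x0 : EuclideanSpace ℝ (Fin d)) (j : ℕ) :
    ∃ s, s + (process ty g b m τ η x0 j).m = j ∧
      IsCycle ty (residual g) (linResidual g xs) b m τ η (process ty g b m τ η x0)
        (linProcess ty g xs b m τ η x0) s (process ty g b m τ η x0 j).m := by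
  induction j with
  | zero =>
    refine ⟨0, rfl, ⟨rfl, rfl, ?_, ?_, ?_⟩⟩ <;> exact fun i hi => absurd hi (Nat.not_lt_zero _)
  | succ j ih =>
    obtain ⟨s, hs, hc⟩ := ih
    by_cases h : ((process ty g b m τ η x0 j).extend ty (residual g) (b j)).Accept ty
        (residual g) m τ η
    · have hS : process ty g b m τ η x0 (j + 1) =
          (process ty g b m τ η x0 j).extend ty (residual g) (b j) := by
        rw [process, if_pos h]
      have hT : linProcess ty g xs b m τ η x0 (j + 1) =
          (linProcess ty g xs b m τ η x0 j).extend ty (linResidual g xs) (b j) := by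
        rw [linProcess, if_neg]
        rw [hS]
        simp
      have hm : (process ty g b m τ η x0 (j + 1)).m = (process ty g b m τ η x0 j).m + 1 := by
        rw [hS]; rfl
      refine ⟨s, by omega, hc.startS, hc.startT, fun i hi => ?_, fun i hi => ?_, fun i hi => ?_⟩
      all_goals
        rw [hm] at hi
        rcases Nat.lt_succ_iff_lt_or_eq.mp hi with hlt | rfl
      · exact hc.extendS i hlt
      · rw [hs]; exact hS
      · exact hc.extendT i hlt
      · rw [hs]; exact hT
      · exact hc.accept i hlt
      · rw [hs, hS]; exact h
    · have hS : process ty g b m τ η x0 (j + 1) =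
          State.restart ((process ty g b m τ η x0 j).xNext ty (residual g) (b j)) := by
        rw [process, if_neg h]
      have hm : (process ty g b m τ η x0 (j + 1)).m = 0 := by rw [hS]; rfl
      refine ⟨j + 1, by omega, ?_, ?_, ?_, ?_, ?_⟩
      · rw [hS]; rfl
      · rw [linProcess, if_pos hm]
      all_goals
        intro i hi
        omega

/-- A restart discards the history but keeps the new iterate. -/
theorem process_succ_x (ty : AMType)
    (g : EuclideanSpace ℝ (Fin d) → EuclideanSpace ℝ (Fin d)) (b : ℕ → ℝ) (m : ℕ) (τ η : ℝ)
    (x0 : EuclideanSpace ℝ (Fin d)) (j : ℕ) :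
    (process ty g b m τ η x0 (j + 1)).x =
      (process ty g b m τ η x0 j).xNext ty (residual g) (b j) := by
  rw [process]
  split_ifs <;> rfl

theorem IsCycle.m_eq {ty : AMType}
    {res lin : EuclideanSpace ℝ (Fin d) → EuclideanSpace ℝ (Fin d)}
    {b : ℕ → ℝ} {m : ℕ} {τ η : ℝ} {S T : ℕ → State d} {s n : ℕ}
    (h : IsCycle ty res lin b m τ η S T s n) {i : ℕ} (hi : i ≤ n) :
    (S (s + i)).m = i ∧ (T (s + i)).m = i := by
  induction i with
  | zero =>
    rw [add_zero, h.startT, h.startS]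
    exact ⟨rfl, rfl⟩
  | succ i ih =>
    rw [← add_assoc, h.extendS i hi, h.extendT i hi]
    simpa using ih (by omega)

end RestartedAM

end

/-! ### Calculus of relative perturbations along a filter -/

noncomputable section

namespace RestartedAM

open Filter Asymptotics

variable {Ω F G K : Type*} [NormedAddCommGroup F]
  [NormedAddCommGroup G] [NormedSpace ℝ G] [NormedAddCommGroup K] [NormedSpace ℝ K]

/-- `u` is of size `O(s)` and approximated by `w` with relative error `O(ε)`. -/
structure Comparable (l : Filter Ω) (ε s : Ω → ℝ) (u w : Ω → F) : Prop where
  bound : u =O[l] s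
  diff : (fun t => u t - w t) =O[l] fun t => ε t * s t

namespace Comparable

variable {l : Filter Ω} {ε s s' : Ω → ℝ} {u w u' w' : Ω → F}

theorem refl (h : u =O[l] s) : Comparable l ε s u u :=
  ⟨h, by simpa using isBigO_zero _ _⟩

theorem congr_scale (h : Comparable l ε s u w) (hs : s =ᶠ[l] s') : Comparable l ε s' u w :=
  ⟨h.bound.congr' .rfl hs, h.diff.congr' .rfl (hs.mono fun t ht => by simp only [ht])⟩

theorem diff_isLittleO (hε : Tendsto ε l (𝓝 0)) (h : Comparable l ε s u w) :
    (fun t => u t - w t) =o[l] s := by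
  refine h.diff.trans_isLittleO ?_
  simpa using (isLittleO_one_iff ℝ |>.mpr hε).mul_isBigO (isBigO_refl s l)

theorem bound_right (hε : Tendsto ε l (𝓝 0)) (h : Comparable l ε s u w) : w =O[l] s := by
  simpa using h.bound.sub (h.diff_isLittleO hε).isBigO

theorem symm (hε : Tendsto ε l (𝓝 0)) (h : Comparable l ε s u w) : Comparable l ε s w u :=
  ⟨h.bound_right hε, by simpa using h.diff.neg_left⟩

theorem add (h : Comparable l ε s u w) (h' : Comparable l ε s u' w') :
    Comparable l ε s (fun t => u t + u' t) (fun t => w t + w' t) :=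
  ⟨h.bound.add h'.bound, (h.diff.add h'.diff).congr_left fun t => by abel⟩

theorem neg (h : Comparable l ε s u w) : Comparable l ε s (fun t => -u t) (fun t => -w t) :=
  ⟨h.bound.neg_left, h.diff.neg_left.congr_left fun t => by abel⟩

theorem sub (h : Comparable l ε s u w) (h' : Comparable l ε s u' w') :
    Comparable l ε s (fun t => u t - u' t) (fun t => w t - w' t) := by
  simpa only [sub_eq_add_neg] using h.add h'.neg

theorem zero : Comparable l ε s (fun _ => (0 : F)) (fun _ => 0) := refl (isBigO_zero _ _)

theorem sum {ι : Type*} {I : Finset ι} {u w : ι → Ω → F}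
    (h : ∀ i ∈ I, Comparable l ε s (u i) (w i)) :
    Comparable l ε s (fun t => ∑ i ∈ I, u i t) (fun t => ∑ i ∈ I, w i t) := by
  refine ⟨IsBigO.fun_sum fun i hi => (h i hi).bound, ?_⟩
  simp only [← Finset.sum_sub_distrib]
  exact IsBigO.fun_sum fun i hi => (h i hi).diff

/-- An error o(s) cannot destroy a lower bound of order s. This is how nondegeneracy passes from one
process to the other. -/
theorem lower_right (hε : Tendsto ε l (𝓝 0)) (h : Comparable l ε s u w) (hlow : s =O[l] u) :
    s =O[l] w := by
  have h1 : (fun t => w t - u t) =o[l] u :=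
    ((h.diff_isLittleO hε).neg_left.congr_left fun t => by abel).trans_isBigO hlow
  refine hlow.trans ?_
  simpa [Pi.add_def] using h1.right_isBigO_add

variable [NormedSpace ℝ F]

theorem isBigO_bilin (B : F →L[ℝ] G →L[ℝ] K) {x : Ω → F} {y : Ω → G} {a b : Ω → ℝ}
    (hx : x =O[l] a) (hy : y =O[l] b) :
    (fun t => B (x t) (y t)) =O[l] fun t => a t * b t := by
  have h1 : (fun t => B (x t) (y t)) =O[l] fun t => ‖x t‖ * ‖y t‖ :=
    .of_bound ‖B‖ (.of_forall fun t => by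
      simpa [mul_assoc] using B.le_opNorm₂ (x t) (y t))
  exact h1.trans (hx.norm_left.mul hy.norm_left)

/-- B(u, y) - B(w, z) = B(u - w, y) + B(w, y - z). -/
theorem bilin (B : F →L[ℝ] G →L[ℝ] K) (hε : Tendsto ε l (𝓝 0)) {y z : Ω → G}
    (h : Comparable l ε s u w) (h' : Comparable l ε s' y z) :
    Comparable l ε (fun t => s t * s' t) (fun t => B (u t) (y t)) (fun t => B (w t) (z t)) := by
  refine ⟨isBigO_bilin B h.bound h'.bound, ?_⟩
  have h1 := isBigO_bilin B h.diff h'.bound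
  have h2 := isBigO_bilin B (h.bound_right hε) h'.diff
  refine ((h1.congr_right fun t => ?_).add (h2.congr_right fun t => ?_)).congr_left fun t => ?_
  · exact mul_assoc _ _ _
  · ring
  · simp

theorem smul (hε : Tendsto ε l (𝓝 0)) {a c : Ω → ℝ} (h : Comparable l ε s a c)
    (h' : Comparable l ε s' u w) :
    Comparable l ε (fun t => s t * s' t) (fun t => a t • u t) (fun t => c t • w t) := by
  simpa using h.bilin (ContinuousLinearMap.lsmul ℝ ℝ) hε h'

theorem mul (hε : Tendsto ε l (𝓝 0)) {a c a' c' : Ω → ℝ} (h : Comparable l ε s a c)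
    (h' : Comparable l ε s' a' c') :
    Comparable l ε (fun t => s t * s' t) (fun t => a t * a' t) (fun t => c t * c' t) :=
  h.smul hε h'

theorem inner {E : Type*} [NormedAddCommGroup E] [InnerProductSpace ℝ E] {u w u' w' : Ω → E}
    (hε : Tendsto ε l (𝓝 0)) (h : Comparable l ε s u w) (h' : Comparable l ε s' u' w') :
    Comparable l ε (fun t => s t * s' t) (fun t => ⟪u t, u' t⟫_ℝ) (fun t => ⟪w t, w' t⟫_ℝ) := by
  exact h.bilin (innerSL ℝ) hε h'

/-- 1/a - 1/c = (c - a)/(ac); the lower bound on a, inherited by c, bounds both reciprocals by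
O(1/s). -/
theorem inv {a c : Ω → ℝ} (hε : Tendsto ε l (𝓝 0)) (h : Comparable l ε s a c)
    (hlow : s =O[l] a) (hs : ∀ᶠ t in l, s t ≠ 0) :
    Comparable l ε (fun t => (s t)⁻¹) (fun t => (a t)⁻¹) (fun t => (c t)⁻¹) := by
  have hlow' := h.lower_right hε hlow
  have ha : ∀ᶠ t in l, a t ≠ 0 := by
    filter_upwards [hs, hlow.eq_zero_imp] with t h1 h2 h3 using h1 (h2 h3)
  have hc : ∀ᶠ t in l, c t ≠ 0 := by
    filter_upwards [hs, hlow'.eq_zero_imp] with t h1 h2 h3 using h1 (h2 h3)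
  have ba : (fun t => (a t)⁻¹) =O[l] fun t => (s t)⁻¹ :=
    hlow.inv_rev (hs.mono fun t h0 h1 => absurd h1 h0)
  have bc : (fun t => (c t)⁻¹) =O[l] fun t => (s t)⁻¹ :=
    hlow'.inv_rev (hs.mono fun t h0 h1 => absurd h1 h0)
  refine ⟨ba, ((h.diff.neg_left.mul ba).mul bc).congr' ?_ ?_⟩
  · filter_upwards [ha, hc] with t h1 h2
    field_simp
    ring
  · filter_upwards [hs] with t h1
    field_simp

theorem div {a c a' c' : Ω → ℝ} (hε : Tendsto ε l (𝓝 0)) (h : Comparable l ε s a c)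
    (h' : Comparable l ε s' a' c') (hlow : s' =O[l] a') (hs : ∀ᶠ t in l, s' t ≠ 0) :
    Comparable l ε (fun t => s t / s' t) (fun t => a t / a' t) (fun t => c t / c' t) := by
  simpa only [div_eq_mul_inv] using h.mul hε (h'.inv hε hlow hs)

end Comparable
end RestartedAM

end

/-! ### Comparison of the two processes over one cycle -/

noncomputable section

namespace RestartedAM

open Filter Asymptotics

variable {d : ℕ}

/-- A cycle of `n` accepted iterations of Process I for a residual `res` that is approximated to
second order at `xs` by `x ↦ -A (x - xs)`, with the accompanying iterations of Process II. -/
structure Cycle (ty : AMType) (d : ℕ) (m : ℕ) (τ η τ₀ β β' μ L : ℝ) (n : ℕ) where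
  res : EuclideanSpace ℝ (Fin d) → EuclideanSpace ℝ (Fin d)
  A : EuclideanSpace ℝ (Fin d) →L[ℝ] EuclideanSpace ℝ (Fin d)
  xs : EuclideanSpace ℝ (Fin d)
  κ : ℝ
  ρ : ℝ
  b : ℕ → ℝ
  s : ℕ
  S : ℕ → State d
  T : ℕ → State d
  κ_pos : 0 < κ
  ρ_pos : 0 < ρ
  norm_le : ∀ y, ‖A y‖ ≤ L * ‖y‖
  le_norm : ∀ y, μ * ‖y‖ ≤ ‖A y‖
  le_inner : ∀ y, μ * ‖y‖ ^ 2 ≤ ⟪y, A y⟫_ℝ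
  taylor : ∀ x, ‖x - xs‖ ≤ ρ → ‖res x + A (x - xs)‖ ≤ 1 / 2 * κ * ‖x - xs‖ ^ 2
  b_bounds : ∀ j, β ≤ |b j| ∧ |b j| ≤ β'
  isCycle : IsCycle ty res (fun x => -(A (x - xs))) b m τ η S T s n
  start_ne : (S s).x ≠ xs
  gamma_sep : ∀ i, 1 ≤ i → i ≤ n → τ₀ ≤ |1 - (S (s + i)).gamma ty res (i - 1)|

namespace Cycle

variable {ty : AMType} {m : ℕ} {τ η τ₀ β β' μ L : ℝ} {n : ℕ}

/-- The residual of the linearized problem. -/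
def lin (c : Cycle ty d m τ η τ₀ β β' μ L n) (x : EuclideanSpace ℝ (Fin d)) :
    EuclideanSpace ℝ (Fin d) := -(c.A (x - c.xs))

/-- The error at the start of the cycle. -/
def err (c : Cycle ty d m τ η τ₀ β β' μ L n) : ℝ := ‖(c.S c.s).x - c.xs‖

/-- The size of the relative perturbation. -/
def eps (c : Cycle ty d m τ η τ₀ β β' μ L n) : ℝ := c.κ * c.err

theorem err_pos (c : Cycle ty d m τ η τ₀ β β' μ L n) : 0 < c.err :=
  norm_pos_iff.mpr (sub_ne_zero.mpr c.start_ne)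

/-- The cycles starting close to the solution. -/
def near : Filter (Cycle ty d m τ η τ₀ β β' μ L n) :=
  comap eps (𝓝 0) ⊓ comap (fun c => c.err / c.ρ) (𝓝 0)

theorem tendsto_eps : Tendsto eps (near : Filter (Cycle ty d m τ η τ₀ β β' μ L n)) (𝓝 0) :=
  tendsto_comap.mono_left inf_le_left

/-- Here C will be the unspecified constant of an O(`err`) bound: points obeying such a bound
eventually lie in the ball where `taylor` applies. -/
theorem eventually_mul_err_le (C : ℝ) :
    ∀ᶠ c in (near : Filter (Cycle ty d m τ η τ₀ β β' μ L n)), C * c.err ≤ c.ρ := by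
  have h : Tendsto (fun c : Cycle ty d m τ η τ₀ β β' μ L n => C * (c.err / c.ρ)) near (𝓝 0) := by
    have h0 : Tendsto (fun c : Cycle ty d m τ η τ₀ β β' μ L n => c.err / c.ρ) near (𝓝 0) :=
      tendsto_comap.mono_left inf_le_right
    simpa using h0.const_mul C
  filter_upwards [h.eventually_le_const one_pos] with c hc
  rw [← mul_div_assoc, div_le_one c.ρ_pos] at hc
  exact hc

/-- A property of cycles that holds eventually holds for all cycles starting in a ball. -/
theorem exists_of_eventually_near {P : Cycle ty d m τ η τ₀ β β' μ L n → Prop}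
    (h : ∀ᶠ c in near, P c) :
    ∃ r > 0, ∀ c, c.eps ≤ r → c.err ≤ r * c.ρ → P c := by
  have hb := ((Metric.nhds_basis_closedBall (x := (0 : ℝ))).comap
    (eps : Cycle ty d m τ η τ₀ β β' μ L n → ℝ)).inf
    ((Metric.nhds_basis_closedBall (x := (0 : ℝ))).comap
      (fun c : Cycle ty d m τ η τ₀ β β' μ L n => c.err / c.ρ))
  obtain ⟨⟨r₁, r₂⟩, ⟨h₁, h₂⟩, hr⟩ := hb.eventually_iff.mp h
  refine ⟨min r₁ r₂, lt_min h₁ h₂, fun c hc₁ hc₂ => hr ⟨?_, ?_⟩⟩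
  · have h0 : 0 ≤ c.eps := mul_nonneg c.κ_pos.le c.err_pos.le
    simpa [abs_of_nonneg h0] using hc₁.trans (min_le_left _ _)
  · have h0 : 0 ≤ c.err / c.ρ := div_nonneg c.err_pos.le c.ρ_pos.le
    have h1 : c.err / c.ρ ≤ r₂ := by
      rw [div_le_iff₀ c.ρ_pos]
      exact hc₂.trans (mul_le_mul_of_nonneg_right (min_le_right _ _) c.ρ_pos.le)
    simpa only [Set.mem_preimage, mem_closedBall_zero_iff, Real.norm_of_nonneg h0] using h1

variable {u w : Cycle ty d m τ η τ₀ β β' μ L n → EuclideanSpace ℝ (Fin d)}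

theorem isBigO_apply {s : Cycle ty d m τ η τ₀ β β' μ L n → ℝ} (h : u =O[near] s) :
    (fun c => c.A (u c)) =O[near] s :=
  (IsBigO.of_bound L (.of_forall fun c => c.norm_le _)).trans h

/-- The remainder ½κ‖u - x*‖² is O(κ · `err`²), and κ · `err` is `eps`. The comparison of the
processes meets the nonlinearity only through this estimate. -/
theorem isBigO_taylor (h : (fun c => u c - c.xs) =O[near] err) :
    (fun c => c.res (u c) + c.A (u c - c.xs)) =O[near] fun c => c.eps * c.err := by
  obtain ⟨C, hC⟩ := h.bound
  have h1 : (fun c => c.res (u c) + c.A (u c - c.xs)) =O[near]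
      fun c => c.κ * ‖u c - c.xs‖ ^ 2 := by
    refine .of_bound (1 / 2) ?_
    filter_upwards [hC, eventually_mul_err_le C] with c h1 h2
    rw [Real.norm_of_nonneg c.err_pos.le] at h1
    refine (c.taylor _ (h1.trans h2)).trans_eq ?_
    rw [Real.norm_of_nonneg (mul_nonneg c.κ_pos.le (sq_nonneg _))]
    ring
  refine h1.trans (((isBigO_refl κ _).mul (h.norm_left.pow 2)).congr_right ?_)
  intro c
  rw [eps]
  ring

theorem comparable_res (h : Comparable near eps err (fun c => u c - c.xs) (fun c => w c - c.xs)) :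
    Comparable near eps err (fun c => c.res (u c)) (fun c => c.lin (w c)) := by
  have ht := isBigO_taylor h.bound
  have h1 : Comparable near eps err (fun c => c.res (u c) + c.A (u c - c.xs)) fun _ => 0 := by
    refine ⟨ht.trans ?_, by simpa using ht⟩
    simpa using (tendsto_eps.isBigO_one ℝ).mul (isBigO_refl err near)
  have h2 : Comparable near eps err (fun c => -c.A (u c - c.xs)) (fun c => -c.A (w c - c.xs)) := by
    refine Comparable.neg ⟨isBigO_apply h.bound, ?_⟩
    simpa only [map_sub] using isBigO_apply h.diff
  have h3 := h1.add h2
  simp only [add_neg_cancel_right, zero_add] at h3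
  exact h3

/-- The states of both processes agree up to a relative error `O(ε)` after `i` iterations. -/
structure StateComparable (ty : AMType) {m : ℕ} {τ η τ₀ β β' μ L : ℝ} {n : ℕ}
    (S T : Cycle ty d m τ η τ₀ β β' μ L n → State d) (i : ℕ) : Prop where
  m_left : ∀ c, (S c).m = i
  m_right : ∀ c, (T c).m = i
  x : Comparable near eps err (fun c => (S c).x - c.xs) (fun c => (T c).x - c.xs)
  p : ∀ j < i, Comparable near eps err (fun c => (S c).p j) (fun c => (T c).p j)
  q : ∀ j < i, Comparable near eps err (fun c => (S c).q j) (fun c => (T c).q j)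
  lower : ∀ j < i, (fun c => err c * err c) =O[near] fun c => ⟪(S c).v ty j, (S c).q j⟫_ℝ

theorem comparable_v {p q p' q' : Cycle ty d m τ η τ₀ β β' μ L n → EuclideanSpace ℝ (Fin d)}
    (hp : Comparable near eps err p p') (hq : Comparable near eps err q q') :
    Comparable near eps err (fun c => ty.v (p c) (q c)) (fun c => ty.v (p' c) (q' c)) := by
  cases ty
  · exact hp
  · exact hq

theorem comparable_smul_of_isBigO_one {a : Cycle ty d m τ η τ₀ β β' μ L n → ℝ}
    {a' : Cycle ty d m τ η τ₀ β β' μ L n → ℝ}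
    (ha : Comparable near eps (fun _ => 1) a a') (h : Comparable near eps err u w) :
    Comparable near eps err (fun c => a c • u c) (fun c => a' c • w c) := by
  simpa using ha.smul tendsto_eps h

theorem comparable_b (j : Cycle ty d m τ η τ₀ β β' μ L n → ℕ) :
    Comparable near eps (fun _ => (1 : ℝ)) (fun c => c.b (j c)) (fun c => c.b (j c)) :=
  .refl (.of_bound β' (.of_forall fun c => by simpa using (c.b_bounds (j c)).2))

namespace StateComparable

variable {S T : Cycle ty d m τ η τ₀ β β' μ L n → State d} {i : ℕ}

theorem v (h : StateComparable ty S T i) {j : ℕ} (hj : j < i) :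
    Comparable near eps err (fun c => (S c).v ty j) (fun c => (T c).v ty j) :=
  comparable_v (h.p j hj) (h.q j hj)

/-- Numerator and denominator both live at scale `err`², so the quotient is of size one; `lower` is
what permits the division. -/
theorem sweepCoeff_of_sweep (h : StateComparable ty S T i) {j : ℕ} (hj : j < i)
    (hs : Comparable near eps err (fun c => sweep ((S c).v ty) (S c).q (u c) j)
      (fun c => sweep ((T c).v ty) (T c).q (w c) j)) :
    Comparable near eps (fun _ => (1 : ℝ)) (fun c => sweepCoeff ((S c).v ty) (S c).q (u c) j)
      (fun c => sweepCoeff ((T c).v ty) (T c).q (w c) j) := by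
  have he : ∀ c : Cycle ty d m τ η τ₀ β β' μ L n, c.err * c.err ≠ 0 := fun c =>
    (mul_pos c.err_pos c.err_pos).ne'
  refine (((h.v hj).inner tendsto_eps hs).div tendsto_eps
    ((h.v hj).inner tendsto_eps (h.q j hj)) (h.lower j hj) (.of_forall he)).congr_scale
    (.of_forall fun c => div_self (he c))

theorem sweep (h : StateComparable ty S T i) (hu : Comparable near eps err u w) {j : ℕ}
    (hj : j ≤ i) :
    Comparable near eps err (fun c => sweep ((S c).v ty) (S c).q (u c) j)
      (fun c => RestartedAM.sweep ((T c).v ty) (T c).q (w c) j) := by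
  induction j with
  | zero => exact hu
  | succ j ih =>
    have ih' := ih (by omega)
    exact ih'.sub (comparable_smul_of_isBigO_one (h.sweepCoeff_of_sweep hj ih') (h.q j hj))

theorem sweepCoeff (h : StateComparable ty S T i) (hu : Comparable near eps err u w) {j : ℕ}
    (hj : j < i) :
    Comparable near eps (fun _ => (1 : ℝ)) (fun c => sweepCoeff ((S c).v ty) (S c).q (u c) j)
      (fun c => RestartedAM.sweepCoeff ((T c).v ty) (T c).q (w c) j) :=
  h.sweepCoeff_of_sweep hj (h.sweep hu hj.le)

theorem gamma (h : StateComparable ty S T i) {j : ℕ} (hj : j < i) :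
    Comparable near eps (fun _ => (1 : ℝ)) (fun c => (S c).gamma ty c.res j)
      (fun c => (T c).gamma ty c.lin j) :=
  h.sweepCoeff (comparable_res h.x) hj

theorem xNext_sub (h : StateComparable ty S T i) (j : Cycle ty d m τ η τ₀ β β' μ L n → ℕ) :
    Comparable near eps err (fun c => (S c).xNext ty c.res (c.b (j c)) - c.xs)
      (fun c => (T c).xNext ty c.lin (c.b (j c)) - c.xs) := by
  have hsum := Comparable.sum (I := Finset.range i) fun j hj =>
    comparable_smul_of_isBigO_one (h.gamma (Finset.mem_range.mp hj)) (h.p j (Finset.mem_range.mp hj))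
  have hr := h.sweep (comparable_res h.x) le_rfl
  have := (h.x.sub hsum).add (comparable_smul_of_isBigO_one (comparable_b j) hr)
  simp only [State.xNext, State.xBar, State.rBar, h.m_left, h.m_right]
  convert! this using 2 <;> abel

theorem res_xNext_sub (h : StateComparable ty S T i) (j : Cycle ty d m τ η τ₀ β β' μ L n → ℕ) :
    Comparable near eps err
      (fun c => c.res ((S c).xNext ty c.res (c.b (j c))) - c.res (S c).x)
      (fun c => c.lin ((T c).xNext ty c.lin (c.b (j c))) - c.lin (T c).x) :=
  (comparable_res (h.xNext_sub j)).sub (comparable_res h.x)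

theorem zeta (h : StateComparable ty S T i) (k : Cycle ty d m τ η τ₀ β β' μ L n → ℕ)
    {j : ℕ} (hj : j < i) :
    Comparable near eps (fun _ => (1 : ℝ)) (fun c => (S c).zeta ty c.res (c.b (k c)) j)
      (fun c => (T c).zeta ty c.lin (c.b (k c)) j) :=
  h.sweepCoeff (h.res_xNext_sub k) hj

theorem pNext (h : StateComparable ty S T i) (k : Cycle ty d m τ η τ₀ β β' μ L n → ℕ) :
    Comparable near eps err (fun c => (S c).pNext ty c.res (c.b (k c)))
      (fun c => (T c).pNext ty c.lin (c.b (k c))) := by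
  have hsum := Comparable.sum (I := Finset.range i) fun j hj =>
    comparable_smul_of_isBigO_one (h.zeta k (Finset.mem_range.mp hj))
      (h.p j (Finset.mem_range.mp hj))
  have := ((h.xNext_sub k).sub h.x).sub hsum
  simpa only [State.pNext, h.m_left, h.m_right, sub_sub_sub_cancel_right] using this

theorem qNext (h : StateComparable ty S T i) (k : Cycle ty d m τ η τ₀ β β' μ L n → ℕ) :
    Comparable near eps err (fun c => (S c).qNext ty c.res (c.b (k c)))
      (fun c => (T c).qNext ty c.lin (c.b (k c))) := by
  simpa only [State.qNext, h.m_left, h.m_right] using h.sweep (h.res_xNext_sub k) le_rfl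

/-- Nondegeneracy of the new pair is the one property that closure of `Comparable` does not supply,
hence the hypothesis `hlow`. -/
theorem extend (h : StateComparable ty S T i) (k : Cycle ty d m τ η τ₀ β β' μ L n → ℕ)
    (hlow : (fun c => err c * err c) =O[near] fun c =>
      ⟪ty.v ((S c).pNext ty c.res (c.b (k c))) ((S c).qNext ty c.res (c.b (k c))),
        (S c).qNext ty c.res (c.b (k c))⟫_ℝ) :
    StateComparable ty (fun c => (S c).extend ty c.res (c.b (k c)))
      (fun c => (T c).extend ty c.lin (c.b (k c))) (i + 1) := by
  refine ⟨fun c => by simp [h.m_left], fun c => by simp [h.m_right], h.xNext_sub k,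
    fun j hj => ?_, fun j hj => ?_, fun j hj => ?_⟩
  all_goals rcases Nat.lt_succ_iff_lt_or_eq.mp hj with hlt | rfl
  · simpa [State.extend, Function.update_apply, h.m_left, h.m_right, hlt.ne] using h.p j hlt
  · simpa [State.extend, h.m_left, h.m_right] using h.pNext k
  · simpa [State.extend, Function.update_apply, h.m_left, h.m_right, hlt.ne] using h.q j hlt
  · simpa [State.extend, h.m_left, h.m_right] using h.qNext k
  · simpa [State.extend, State.v, Function.update_apply, h.m_left, h.m_right, hlt.ne]
      using h.lower j hlt
  · simpa [State.extend, State.v, h.m_left, h.m_right] using hlow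

end StateComparable

/-- The first step of the linearized process is not degenerate. -/
theorem inner_first_step_ge (hβ : 0 < β) (hμ : 0 < μ) (c : Cycle ty d m τ η τ₀ β β' μ L n) :
    min μ (μ ^ 2) * (β * μ) ^ 2 * (c.err * c.err) ≤
      |⟪ty.v ((State.restart (c.S c.s).x).pNext ty c.lin (c.b c.s))
          ((State.restart (c.S c.s).x).qNext ty c.lin (c.b c.s)),
        (State.restart (c.S c.s).x).qNext ty c.lin (c.b c.s)⟫_ℝ| := by
  set x := (c.S c.s).x with hx
  set y := c.b c.s • c.lin x with hy
  have hp : (State.restart x).pNext ty c.lin (c.b c.s) = y := by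
    simp [State.pNext, State.xNext, State.xBar, State.rBar, State.restart, RestartedAM.sweep, hy]
  have hq : (State.restart x).qNext ty c.lin (c.b c.s) = -c.A y := by
    have : (State.restart x).xNext ty c.lin (c.b c.s) = x + y := by
      simp [State.xNext, State.xBar, State.rBar, State.restart, RestartedAM.sweep, hy]
    simp only [State.qNext, this]
    simp only [State.restart, RestartedAM.sweep, lin, map_sub, map_add]
    abel
  have hynorm : β * μ * c.err ≤ ‖y‖ := by
    rw [hy, norm_smul, lin, norm_neg, mul_assoc]
    exact mul_le_mul (c.b_bounds _).1 (c.le_norm _) (mul_nonneg hμ.le c.err_pos.le) (abs_nonneg _)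
  have hsq : (β * μ) ^ 2 * (c.err * c.err) ≤ ‖y‖ ^ 2 := by
    have h0 : 0 ≤ β * μ * c.err := mul_nonneg (mul_nonneg hβ.le hμ.le) c.err_pos.le
    calc _ = (β * μ * c.err) ^ 2 := by ring
      _ ≤ _ := by gcongr
  rw [hp, hq, mul_assoc]
  have hmin : 0 ≤ min μ (μ ^ 2) := le_min hμ.le (sq_nonneg _)
  refine (mul_le_mul_of_nonneg_left hsq hmin).trans ?_
  cases ty
  · simp only [AMType.v, inner_neg_right, abs_neg]
    refine (mul_le_mul_of_nonneg_right (min_le_left _ _) (sq_nonneg _)).trans ?_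
    exact (c.le_inner y).trans (le_abs_self _)
  · simp only [AMType.v, real_inner_self_eq_norm_sq, norm_neg]
    refine (mul_le_mul_of_nonneg_right (min_le_right _ _) (sq_nonneg _)).trans ?_
    rw [← mul_pow, abs_of_nonneg (sq_nonneg _)]
    exact pow_le_pow_left₀ (mul_nonneg hμ.le (norm_nonneg _)) (c.le_norm y) 2

theorem stateComparable (hτ : 0 < τ) (hβ : 0 < β) (hμ : 0 < μ) {i : ℕ} (hi : i ≤ n) :
    StateComparable ty (fun c : Cycle ty d m τ η τ₀ β β' μ L n => c.S (c.s + i))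
      (fun c => c.T (c.s + i)) i := by
  induction i with
  | zero =>
    refine ⟨fun c => (c.isCycle.m_eq hi).1, fun c => (c.isCycle.m_eq hi).2, ?_,
      fun j hj => absurd hj (Nat.not_lt_zero _), fun j hj => absurd hj (Nat.not_lt_zero _),
      fun j hj => absurd hj (Nat.not_lt_zero _)⟩
    have : ∀ c : Cycle ty d m τ η τ₀ β β' μ L n, (c.T c.s).x = (c.S c.s).x := fun c => by
      rw [c.isCycle.startT]; rfl
    simp only [add_zero, this]
    exact .refl (.of_norm_left (isBigO_refl _ _))
  | succ i ih =>
    have h := ih (by omega)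
    have hS : ∀ c : Cycle ty d m τ η τ₀ β β' μ L n,
        c.S (c.s + (i + 1)) = (c.S (c.s + i)).extend ty c.res (c.b (c.s + i)) := fun c =>
      c.isCycle.extendS i hi
    have hT : ∀ c : Cycle ty d m τ η τ₀ β β' μ L n,
        c.T (c.s + (i + 1)) = (c.T (c.s + i)).extend ty c.lin (c.b (c.s + i)) := fun c =>
      c.isCycle.extendT i hi
    simp only [hS, hT]
    refine h.extend (fun c => c.s + i) ?_
    rcases Nat.eq_zero_or_pos i with rfl | hpos
    -- First pair: the lower bound is known for the linear process, from positive definiteness, and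
    -- is carried back to Process I by `symm` and `lower_right`.
    · have hc := (comparable_v (h.pNext fun c => c.s + 0) (h.qNext fun c => c.s + 0)).inner
        tendsto_eps (h.qNext fun c => c.s + 0)
      refine (hc.symm tendsto_eps).lower_right tendsto_eps ?_
      have hk : 0 < min μ (μ ^ 2) * (β * μ) ^ 2 := by positivity
      refine .of_bound (min μ (μ ^ 2) * (β * μ) ^ 2)⁻¹ (.of_forall fun c => ?_)
      rw [← div_eq_inv_mul, le_div_iff₀ hk, mul_comm,
        Real.norm_of_nonneg (mul_nonneg c.err_pos.le c.err_pos.le)]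
      have := inner_first_step_ge hβ hμ c
      simpa only [add_zero, c.isCycle.startT, Real.norm_eq_abs] using this
    -- Later pairs: the acceptance test compares the new pair with the first one of the cycle, at
    -- the cost of a factor 1/τ.
    · refine (h.lower 0 hpos).trans (.of_bound τ⁻¹ (.of_forall fun c => ?_))
      have hacc := (c.isCycle.accept i hi).2.2
      have hm := (c.isCycle.m_eq (i := i) (by omega)).1
      rw [c.isCycle.extendS i hi, State.extend_v_of_lt _ _ (by omega),
        State.extend_q_of_lt _ _ (by omega), State.extend_m, Nat.add_sub_cancel,
        State.extend_v_self, State.extend_q_self] at hacc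
      rw [← div_eq_inv_mul, le_div_iff₀ hτ, mul_comm]
      exact hacc

/-! ### Hessenberg entries, well-posedness and uniform constants -/

theorem isBigO_one_sub_gamma (hτ₀ : 0 < τ₀) {i : ℕ} (hi : i < n) :
    (fun _ => (1 : ℝ)) =O[near] fun c : Cycle ty d m τ η τ₀ β β' μ L n =>
      1 - (c.S (c.s + i + 1)).gamma ty c.res i := by
  refine .of_bound τ₀⁻¹ (.of_forall fun c => ?_)
  rw [← div_eq_inv_mul, le_div_iff₀ hτ₀, norm_one, one_mul]
  exact c.gamma_sep (i + 1) (by omega) hi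

/-- The entries of the Hessenberg matrices of both processes agree up to `O(ε)`. -/
theorem comparable_hessBar (hτ : 0 < τ) (hβ : 0 < β) (hμ : 0 < μ) (hτ₀ : 0 < τ₀)
    {r : ℕ} (hr : r ≤ n) (i : Fin (r + 1)) (j : Fin r) :
    Comparable near eps (fun _ => (1 : ℝ))
      (fun c : Cycle ty d m τ η τ₀ β β' μ L n =>
        hessBar c.b (fun l => (c.S l).gamma ty c.res)
          (fun l i => (c.S l).gamma ty c.res i + (c.S l).zeta ty c.res (c.b l) i) c.s r i j)
      (fun c => hessBar c.b (fun l => (c.T l).gamma ty c.lin)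
          (fun l i => (c.T l).gamma ty c.lin i + (c.T l).zeta ty c.lin (c.b l) i) c.s r i j) := by
  induction r with
  | zero => exact j.elim0
  | succ r ih =>
    have hst : ∀ {k}, k ≤ n → StateComparable ty
        (fun c : Cycle ty d m τ η τ₀ β β' μ L n => c.S (c.s + k)) (fun c => c.T (c.s + k)) k :=
      stateComparable hτ hβ hμ
    have one : Comparable (near : Filter (Cycle ty d m τ η τ₀ β β' μ L n)) eps
      (fun _ => (1 : ℝ)) (fun _ => (1 : ℝ)) (fun _ => 1) := .refl (isBigO_refl _ _)
    have mul1 : ∀ {a a' e e' : Cycle ty d m τ η τ₀ β β' μ L n → ℝ},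
        Comparable near eps (fun _ => (1 : ℝ)) a a' → Comparable near eps (fun _ => (1 : ℝ)) e e' →
        Comparable near eps (fun _ => (1 : ℝ)) (fun c => a c * e c) (fun c => a' c * e' c) :=
      fun ha he => by simpa using ha.mul tendsto_eps he
    have hγ : ∀ {k}, k ≤ n → ∀ j < k, _ := fun {k} hk j hj => (hst hk).gamma hj
    have hφ : ∀ {k}, k ≤ n → ∀ j < k, _ := fun {k} hk j hj =>
      ((hst hk).gamma hj).add ((hst hk).zeta (fun c => c.s + k) hj)
    have hb : ∀ k, Comparable near eps (fun _ => (1 : ℝ))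
        (fun c : Cycle ty d m τ η τ₀ β β' μ L n => 1 / c.b (c.s + k))
        (fun c => 1 / c.b (c.s + k)) := fun k => by
      refine (one.div tendsto_eps (comparable_b fun c => c.s + k) ?_ (by simp)).congr_scale
        (by simp)
      refine .of_bound β⁻¹ (.of_forall fun c => ?_)
      rw [← div_eq_inv_mul, le_div_iff₀ hβ, norm_one, one_mul]
      exact (c.b_bounds _).1
    -- The separation τ₀ is given for Process I only; division in `Comparable` needs the lower bound
    -- on that side alone.
    have hden : Comparable near eps (fun _ => (1 : ℝ))
        (fun c : Cycle ty d m τ η τ₀ β β' μ L n =>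
          1 / (1 - (c.S (c.s + r + 1)).gamma ty c.res r))
        (fun c => 1 / (1 - (c.T (c.s + r + 1)).gamma ty c.lin r)) :=
      (one.div tendsto_eps (one.sub (hγ hr r (by omega))) (isBigO_one_sub_gamma hτ₀ hr)
        (by simp)).congr_scale (by simp)
    simp only [hessBar, Matrix.of_apply]
    refine Fin.lastCases ?_ (fun j' => ?_) j
    · simp only [Fin.snoc_last]
      refine Fin.lastCases ?_ (fun i' => ?_) i
      · simp only [Fin.snoc_last]
        have := (mul1 (hb (r + 1)) hden).neg
        simpa only [one_div_mul_one_div, add_assoc] using this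
      · simp only [Fin.snoc_castSucc, Pi.smul_apply, Pi.sub_apply, smul_eq_mul, Matrix.mulVec,
          dotProduct]
        refine mul1 hden (((mul1 (hb r) ?_).sub (mul1 (hb (r + 1)) ?_)).sub
          (Comparable.sum fun l _ => mul1 (ih (by omega) i' l) ?_))
        · refine Fin.lastCases ?_ (fun i'' => ?_) i'
          · simpa only [Fin.snoc_last] using one
          · simpa only [Fin.snoc_castSucc] using hφ (k := r) (by omega) i'' i''.2
        · exact hφ hr i' i'.2
        · exact (hφ (k := r) (by omega) l l.2).sub (hγ hr l (by omega))
    · simp only [Fin.snoc_castSucc]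
      refine Fin.lastCases ?_ (fun i' => ?_) i
      · simp only [Fin.snoc_last]
        exact .zero
      · simp only [Fin.snoc_castSucc]
        exact ih (by omega) i' j'

theorem StateComparable.eventually_inner_ne_zero
    {S T : Cycle ty d m τ η τ₀ β β' μ L n → State d} {i : ℕ} (h : StateComparable ty S T i) :
    ∀ᶠ c in near, ∀ j < i, ⟪(S c).v ty j, (S c).q j⟫_ℝ ≠ 0 ∧ ⟪(T c).v ty j, (T c).q j⟫_ℝ ≠ 0 := by
  refine (Set.finite_lt_nat i).eventually_all.mpr fun j hj => ?_
  have hlow := ((h.v hj).inner tendsto_eps (h.q j hj)).lower_right tendsto_eps (h.lower j hj)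
  filter_upwards [(h.lower j hj).eq_zero_imp, hlow.eq_zero_imp] with c h1 h2
  have he := (mul_pos c.err_pos c.err_pos).ne'
  exact ⟨fun h => he (h1 h), fun h => he (h2 h)⟩

theorem eventually_wellPosed (hτ : 0 < τ) (hβ : 0 < β) (hμ : 0 < μ) (hτ₀ : 0 < τ₀) :
    ∀ᶠ c in (near : Filter (Cycle ty d m τ η τ₀ β β' μ L n)),
      (c.S (c.s + n)).WellPosed ty c.res (c.b (c.s + n)) ∧
        (c.T (c.s + n)).WellPosed ty c.lin (c.b (c.s + n)) := by
  have h : StateComparable ty (fun c : Cycle ty d m τ η τ₀ β β' μ L n => c.S (c.s + n))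
    (fun c => c.T (c.s + n)) n := stateComparable hτ hβ hμ le_rfl
  have hgamma : ∀ᶠ c in (near : Filter (Cycle ty d m τ η τ₀ β β' μ L n)),
      0 < n → (c.T (c.s + n)).gamma ty c.lin (n - 1) ≠ 1 := by
    rcases Nat.eq_zero_or_pos n with rfl | hn
    · simp
    · obtain ⟨k, rfl⟩ : ∃ k, n = k + 1 := ⟨n - 1, by omega⟩
      have one : Comparable (near : Filter (Cycle ty d m τ η τ₀ β β' μ L (k + 1))) eps
        (fun _ => (1 : ℝ)) (fun _ => (1 : ℝ)) (fun _ => 1) := .refl (isBigO_refl _ _)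
      have hlow := (one.sub (h.gamma (j := k) (by omega))).lower_right tendsto_eps
        (isBigO_one_sub_gamma hτ₀ (Nat.lt_succ_self k))
      filter_upwards [hlow.eq_zero_imp] with c hc _ h1
      exact one_ne_zero (hc (sub_eq_zero.mpr h1.symm))
  filter_upwards [h.eventually_inner_ne_zero, hgamma] with c hc hg
  obtain ⟨hmS, hmT⟩ := c.isCycle.m_eq le_rfl
  constructor
  · refine (State.lowerTriangular_of_extend c.isCycle.startS c.isCycle.extendS
      fun j hj => (hc j hj).1).wellPosed (fun j hj => (hc j (hmS ▸ hj)).1) (fun hpos h1 => ?_) _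
    rw [hmS] at hpos h1
    have := c.gamma_sep n hpos le_rfl
    rw [h1, sub_self, abs_zero] at this
    exact absurd hτ₀ (not_lt.mpr this)
  · refine (State.lowerTriangular_of_extend c.isCycle.startT c.isCycle.extendT
      fun j hj => (hc j hj).2).wellPosed (fun j hj => (hc j (hmT ▸ hj)).2) (fun hpos => ?_) _
    rw [hmT] at hpos ⊢
    exact hg hpos

/-- The matrix `H_k` of Process I at the end of the cycle. -/
def hessI (c : Cycle ty d m τ η τ₀ β β' μ L n) (i j : Fin n) : ℝ :=
  hessBar c.b (fun l => (c.S l).gamma ty c.res)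
    (fun l i => (c.S l).gamma ty c.res i + (c.S l).zeta ty c.res (c.b l) i) c.s n i.castSucc j

/-- The matrix `H_k` of Process II at the end of the cycle. -/
def hessII (c : Cycle ty d m τ η τ₀ β β' μ L n) (i j : Fin n) : ℝ :=
  hessBar c.b (fun l => (c.T l).gamma ty c.lin)
    (fun l i => (c.T l).gamma ty c.lin i + (c.T l).zeta ty c.lin (c.b l) i) c.s n i.castSucc j

/-- The properties of a cycle, with constant `C`. -/
structure Bounds (C : ℝ) (c : Cycle ty d m τ η τ₀ β β' μ L n) : Prop where
  wellPosed : (c.S (c.s + n)).WellPosed ty c.res (c.b (c.s + n)) ∧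
    (c.T (c.s + n)).WellPosed ty c.lin (c.b (c.s + n))
  next_le : ‖(c.S (c.s + n)).xNext ty c.res (c.b (c.s + n)) - c.xs‖ ≤ C * c.err
  hessI_le : ∀ i j, |c.hessI i j| ≤ C
  hessII_le : ∀ i j, |c.hessII i j| ≤ C
  sub_le : ∀ i j, |c.hessI i j - c.hessII i j| ≤ C * c.eps

theorem Bounds.mono {C C' : ℝ} {c : Cycle ty d m τ η τ₀ β β' μ L n} (h : Bounds C c)
    (hC : C ≤ C') : Bounds C' c :=
  ⟨h.wellPosed, h.next_le.trans (mul_le_mul_of_nonneg_right hC c.err_pos.le),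
    fun i j => (h.hessI_le i j).trans hC, fun i j => (h.hessII_le i j).trans hC,
    fun i j => (h.sub_le i j).trans
      (mul_le_mul_of_nonneg_right hC (mul_nonneg c.κ_pos.le c.err_pos.le))⟩

theorem exists_eventually_bounds (hτ : 0 < τ) (hβ : 0 < β) (hμ : 0 < μ) (hτ₀ : 0 < τ₀) :
    ∃ C : ℝ, ∀ᶠ c in (near : Filter (Cycle ty d m τ η τ₀ β β' μ L n)), Bounds C c := by
  have h : StateComparable ty (fun c : Cycle ty d m τ η τ₀ β β' μ L n => c.S (c.s + n))
    (fun c => c.T (c.s + n)) n := stateComparable hτ hβ hμ le_rfl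
  have hcomp : ∀ i j : Fin n, Comparable near eps (fun _ => (1 : ℝ))
      (fun c : Cycle ty d m τ η τ₀ β β' μ L n => c.hessI i j) (fun c => c.hessII i j) :=
    fun i j => comparable_hessBar hτ hβ hμ hτ₀ le_rfl i.castSucc j
  have ev : ∀ᶠ C : ℝ in atTop,
      (∀ᶠ c in (near : Filter (Cycle ty d m τ η τ₀ β β' μ L n)),
        ‖(c.S (c.s + n)).xNext ty c.res (c.b (c.s + n)) - c.xs‖ ≤ C * ‖c.err‖) ∧
      ∀ i j, (∀ᶠ c in (near : Filter (Cycle ty d m τ η τ₀ β β' μ L n)),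
          ‖c.hessI i j‖ ≤ C * ‖(1 : ℝ)‖) ∧
        (∀ᶠ c in (near : Filter (Cycle ty d m τ η τ₀ β β' μ L n)),
          ‖c.hessII i j‖ ≤ C * ‖(1 : ℝ)‖) ∧
        ∀ᶠ c in (near : Filter (Cycle ty d m τ η τ₀ β β' μ L n)),
          ‖c.hessI i j - c.hessII i j‖ ≤ C * ‖c.eps * 1‖ := by
    refine (isBigO_iff_eventually.mp (h.xNext_sub fun c => c.s + n).bound).and
      (eventually_all.mpr fun i => eventually_all.mpr fun j => ?_)
    exact (isBigO_iff_eventually.mp (hcomp i j).bound).and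
      ((isBigO_iff_eventually.mp ((hcomp i j).bound_right tendsto_eps)).and
        (isBigO_iff_eventually.mp (hcomp i j).diff))
  obtain ⟨C, h1, h2⟩ := ev.exists
  have h3 := eventually_all.mpr fun i => eventually_all.mpr fun j => (h2 i j).1
  have h4 := eventually_all.mpr fun i => eventually_all.mpr fun j => (h2 i j).2.1
  have h5 := eventually_all.mpr fun i => eventually_all.mpr fun j => (h2 i j).2.2
  refine ⟨C, ?_⟩
  filter_upwards [eventually_wellPosed hτ hβ hμ hτ₀, h1, h3, h4, h5] with c hw h1 h3 h4 h5
  have he : 0 ≤ c.eps := mul_nonneg c.κ_pos.le c.err_pos.le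
  rw [Real.norm_of_nonneg c.err_pos.le] at h1
  simp only [norm_one, mul_one, Real.norm_of_nonneg he, Real.norm_eq_abs] at h3 h4 h5
  exact ⟨hw, h1, h3, h4, h5⟩

variable (ty d m η β' L) in
/-- Uniform bounds for all cycles of at most `N` steps that start close to the solution. -/
theorem exists_bounds (hτ : 0 < τ) (hβ : 0 < β) (hμ : 0 < μ) (hτ₀ : 0 < τ₀) (N : ℕ) :
    ∃ C > 0, ∃ r > 0, ∀ n ≤ N, ∀ c : Cycle ty d m τ η τ₀ β β' μ L n,
      c.eps ≤ r → c.err ≤ r * c.ρ → Bounds C c := by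
  induction N with
  | zero =>
    obtain ⟨C, hC⟩ := exists_eventually_bounds (ty := ty) (d := d) (m := m) (η := η) (β' := β')
      (L := L) (n := 0) hτ hβ hμ hτ₀
    obtain ⟨r, hr, h⟩ := exists_of_eventually_near hC
    refine ⟨max C 1, by positivity, r, hr, fun n hn c h1 h2 => ?_⟩
    obtain rfl := Nat.le_zero.mp hn
    exact (h c h1 h2).mono (le_max_left _ _)
  | succ N ih =>
    obtain ⟨C₀, hC₀, r₀, hr₀, h₀⟩ := ih
    obtain ⟨C, hC⟩ := exists_eventually_bounds (ty := ty) (d := d) (m := m) (η := η) (β' := β')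
      (L := L) (n := N + 1) hτ hβ hμ hτ₀
    obtain ⟨r, hr, h⟩ := exists_of_eventually_near hC
    refine ⟨max C C₀, lt_max_of_lt_right hC₀, min r r₀, lt_min hr hr₀, fun n hn c h1 h2 => ?_⟩
    have hρ := c.ρ_pos.le
    rcases Nat.le_succ_iff.mp hn with hle | rfl
    · exact (h₀ n hle c (h1.trans (min_le_right _ _))
        (h2.trans (mul_le_mul_of_nonneg_right (min_le_right _ _) hρ))).mono (le_max_right _ _)
    · exact (h c (h1.trans (min_le_left _ _))
        (h2.trans (mul_le_mul_of_nonneg_right (min_le_left _ _) hρ))).mono (le_max_left _ _)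

end Cycle
end RestartedAM

end

/-! ### Perturbation of determinants and eigenvalues -/

noncomputable section

namespace RestartedAM

theorem norm_scalar_sub_apply_sub {n : ℕ} {A B : Matrix (Fin n) (Fin n) ℂ} {lam : ℂ} (i j : Fin n) :
    ‖(Matrix.scalar (Fin n) lam - A) i j - (Matrix.scalar (Fin n) lam - B) i j‖ =
      ‖A i j - B i j‖ := by
  rw [Matrix.sub_apply, Matrix.sub_apply, sub_sub_sub_cancel_left, norm_sub_rev]

/-- The determinant is Lipschitz on bounded sets of matrices. -/
theorem exists_norm_det_sub_le (n : ℕ) (R : ℝ) : ∃ C : ℝ, 0 ≤ C ∧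
    ∀ (A B : Matrix (Fin n) (Fin n) ℂ) (t : ℝ), 0 ≤ t → (∀ i j, ‖A i j‖ ≤ R) →
      (∀ i j, ‖B i j‖ ≤ R) → (∀ i j, ‖A i j - B i j‖ ≤ t) → ‖A.det - B.det‖ ≤ C * t := by
  -- A polynomial in the entries is C¹, hence Lipschitz on compact sets. The radius `max R 0` below
  -- stays nonnegative even when R < 0.
  have hdet : ContDiff ℝ 1 fun A : Fin n → Fin n → ℂ => (Matrix.of A).det := by
    simp only [Matrix.det_apply', Matrix.of_apply]
    fun_prop
  obtain ⟨C, hC⟩ := hdet.locallyLipschitz.locallyLipschitzOn.exists_lipschitzOnWith_of_compact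
    (isCompact_closedBall (0 : Fin n → Fin n → ℂ) (max R 0))
  refine ⟨C, C.2, fun A B t ht hA hB hAB => ?_⟩
  have mem : ∀ A : Matrix (Fin n) (Fin n) ℂ, (∀ i j, ‖A i j‖ ≤ R) →
      (fun i j => A i j) ∈ Metric.closedBall (0 : Fin n → Fin n → ℂ) (max R 0) := fun A hA => by
    rw [mem_closedBall_zero_iff]
    refine (pi_norm_le_iff_of_nonneg (le_max_right _ _)).mpr fun i =>
      (pi_norm_le_iff_of_nonneg (le_max_right _ _)).mpr fun j => (hA i j).trans (le_max_left _ _)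
  have h := hC.norm_sub_le (mem A hA) (mem B hB)
  refine h.trans (mul_le_mul_of_nonneg_left ?_ C.2)
  exact (pi_norm_le_iff_of_nonneg ht).mpr fun i => (pi_norm_le_iff_of_nonneg ht).mpr fun j => hAB i j

/-- Gershgorin: the eigenvalue lies in a disc about some diagonal entry whose radius is the
off-diagonal row sum. -/
theorem norm_le_of_mem_spectrum {n : ℕ} {A : Matrix (Fin n) (Fin n) ℂ} {R : ℝ}
    (hA : ∀ i j, ‖A i j‖ ≤ R) {lam : ℂ} (h : lam ∈ spectrum ℂ A) : ‖lam‖ ≤ n * R := by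
  rw [← Matrix.spectrum_toLin', ← Module.End.hasEigenvalue_iff_mem_spectrum] at h
  obtain ⟨k, hk⟩ := eigenvalue_mem_ball h
  rw [mem_closedBall_iff_norm] at hk
  calc ‖lam‖ ≤ ‖A k k‖ + ‖lam - A k k‖ := norm_le_insert' _ _
    _ ≤ ‖A k k‖ + ∑ j ∈ Finset.univ.erase k, ‖A k j‖ := by gcongr
    _ = ∑ j, ‖A k j‖ := Finset.add_sum_erase _ (fun j => ‖A k j‖) (Finset.mem_univ k)
    _ ≤ n * R := by simpa using Finset.sum_le_card_nsmul Finset.univ _ R fun j _ => hA k j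

/-- A point at which the characteristic polynomial of `B` is small is close to an eigenvalue. -/
theorem exists_mem_spectrum_norm_sub_le {n : ℕ} (hn : n ≠ 0) (B : Matrix (Fin n) (Fin n) ℂ)
    (lam : ℂ) {t : ℝ} (h : ‖(Matrix.scalar (Fin n) lam - B).det‖ ≤ t) :
    ∃ z ∈ spectrum ℂ B, ‖z - lam‖ ≤ t ^ (1 / (n : ℝ)) := by
  by_contra! hcon
  have ht : 0 ≤ t := (norm_nonneg _).trans h
  rw [← Matrix.eval_charpoly] at h
  have hs := IsAlgClosed.splits B.charpoly
  have hcard : B.charpoly.roots.card = n := by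
    rw [← hs.natDegree_eq_card_roots, Matrix.charpoly_natDegree_eq_dim, Fintype.card_fin]
  rw [hs.eval_eq_prod_roots_of_monic B.charpoly_monic] at h
  set s := B.charpoly.roots with hsdef
  have hroot : ∀ z ∈ s, t ^ (1 / (n : ℝ)) < ‖lam - z‖ := fun z hz => by
    rw [norm_sub_rev]
    exact hcon z (Matrix.mem_spectrum_iff_isRoot_charpoly.mpr (Polynomial.isRoot_of_mem_roots hz))
  -- If all n roots were farther than t^{1/n}, the product of the distances would exceed t. The
  -- empty multiset is excluded because strictness fails there (1 < 1).
  have key : ∀ s' : Multiset ℂ, s' ≠ 0 → (∀ z ∈ s', t ^ (1 / (n : ℝ)) < ‖lam - z‖) →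
      (t ^ (1 / (n : ℝ))) ^ s'.card < ‖(s'.map fun z => lam - z).prod‖ := by
    intro s'
    induction s' using Multiset.induction with
    | empty => simp
    | cons a s' ih =>
      intro _ hall
      have ha := hall a (Multiset.mem_cons_self a s')
      by_cases h0 : s' = 0
      · simpa [h0] using ha
      · have := ih h0 fun z hz => hall z (Multiset.mem_cons_of_mem hz)
        simp only [Multiset.card_cons, Multiset.map_cons, Multiset.prod_cons, norm_mul, pow_succ']
        exact mul_lt_mul'' ha this (by positivity) (by positivity)
  have h1 := key s (by rintro h0; rw [h0] at hcard; exact hn hcard.symm) hroot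
  rw [hcard, ← Real.rpow_natCast, ← Real.rpow_mul ht, one_div_mul_cancel (by exact_mod_cast hn),
    Real.rpow_one] at h1
  exact absurd h (not_le.mpr h1)

/-- Perturbation of eigenvalues of bounded matrices. -/
theorem exists_spectrum_perturbation (n : ℕ) (R : ℝ) : ∃ C : ℝ, 0 ≤ C ∧
    ∀ (A B : Matrix (Fin n) (Fin n) ℂ) (t : ℝ), n ≠ 0 → 0 ≤ t → (∀ i j, ‖A i j‖ ≤ R) →
      (∀ i j, ‖B i j‖ ≤ R) → (∀ i j, ‖A i j - B i j‖ ≤ t) →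
      ∀ lam ∈ spectrum ℂ A, ∃ z ∈ spectrum ℂ B, ‖z - lam‖ ≤ (C * t) ^ (1 / (n : ℝ)) := by
  -- Entries of λI - A and λI - B are at most nR + R, as |λ| ≤ nR by Gershgorin.
  obtain ⟨C, hC0, hC⟩ := exists_norm_det_sub_le n (n * R + R)
  refine ⟨C, hC0, fun A B t hn ht hA hB hAB lam hlam => ?_⟩
  refine exists_mem_spectrum_norm_sub_le hn B lam ?_
  have hnorm := norm_le_of_mem_spectrum hA hlam
  have hscalar : ∀ i j, ‖Matrix.scalar (Fin n) lam i j‖ ≤ n * R := fun i j => by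
    rw [Matrix.scalar_apply, Matrix.diagonal_apply]
    split_ifs
    · exact hnorm
    · simpa using (norm_nonneg _).trans hnorm
  have h0 : (Matrix.scalar (Fin n) lam - A).det = 0 := by
    rw [← Matrix.eval_charpoly]
    exact Matrix.mem_spectrum_iff_isRoot_charpoly.mp hlam
  have h := hC (Matrix.scalar (Fin n) lam - B) (Matrix.scalar (Fin n) lam - A) t ht
    (fun i j => (norm_sub_le _ _).trans (add_le_add (hscalar i j) (hB i j)))
    (fun i j => (norm_sub_le _ _).trans (add_le_add (hscalar i j) (hA i j)))
    (fun i j => by rw [norm_scalar_sub_apply_sub, norm_sub_rev]; exact hAB i j)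
  rwa [h0, sub_zero] at h

/-! ### Spectral norm and the Bauer–Fike estimate -/

theorem specNorm_mulVec_le {n : ℕ} (M : Matrix (Fin n) (Fin n) ℂ) (x : EuclideanSpace ℂ (Fin n)) :
    ‖Matrix.toEuclideanCLM (n := Fin n) (𝕜 := ℂ) M x‖ ≤ specNorm M * ‖x‖ :=
  ContinuousLinearMap.le_opNorm _ _

/-- A linear map out of a finite-dimensional space is bounded; here it goes from matrices with the
entrywise maximum norm to operators. -/
theorem exists_specNorm_le (n : ℕ) : ∃ C : ℝ, 0 ≤ C ∧
    ∀ (A : Matrix (Fin n) (Fin n) ℂ) (t : ℝ), 0 ≤ t → (∀ i j, ‖A i j‖ ≤ t) →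
      specNorm A ≤ C * t := by
  let f : (Fin n → Fin n → ℂ) →ₗ[ℂ] (EuclideanSpace ℂ (Fin n) →L[ℂ] EuclideanSpace ℂ (Fin n)) :=
    { toFun := fun A => Matrix.toEuclideanCLM (n := Fin n) (𝕜 := ℂ) (Matrix.of A)
      map_add' := fun A B => map_add (Matrix.toEuclideanCLM (n := Fin n) (𝕜 := ℂ)) _ _
      map_smul' := fun c A => map_smul (Matrix.toEuclideanCLM (n := Fin n) (𝕜 := ℂ)) c _ }
  let F := LinearMap.toContinuousLinearMap f
  refine ⟨‖F‖, F.opNorm_nonneg, fun A t ht hA => ?_⟩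
  refine (F.le_opNorm A).trans (mul_le_mul_of_nonneg_left ?_ F.opNorm_nonneg)
  exact (pi_norm_le_iff_of_nonneg ht).mpr fun i => (pi_norm_le_iff_of_nonneg ht).mpr (hA i)

/-- The Bauer-Fike theorem. -/
theorem bauer_fike {n : ℕ} {A B M : Matrix (Fin n) (Fin n) ℂ} {D : Fin n → ℂ}
    (hM : IsUnit M.det) (hB : B = M * Matrix.diagonal D * M⁻¹) {lam : ℂ}
    (hlam : lam ∈ spectrum ℂ A) :
    ∃ z ∈ spectrum ℂ B, ‖z - lam‖ ≤ specNorm M * specNorm M⁻¹ * specNorm (A - B) := by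
  have hinv : M⁻¹ * M = 1 := Matrix.nonsing_inv_mul M hM
  have hinv' : M * M⁻¹ = 1 := Matrix.mul_nonsing_inv M hM
  have hspec : spectrum ℂ B = Set.range D := by
    let U : (Matrix (Fin n) (Fin n) ℂ)ˣ := ⟨M, M⁻¹, hinv', hinv⟩
    rw [hB, ← spectrum_diagonal]
    exact spectrum.units_conjugate (u := U)
  rw [← Matrix.spectrum_toLpLin 2, ← Module.End.hasEigenvalue_iff_mem_spectrum] at hlam
  obtain ⟨x, hx⟩ := hlam.exists_hasEigenvector
  let Φ := Matrix.toEuclideanCLM (n := Fin n) (𝕜 := ℂ)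
  have hAx : Φ A x = lam • x := hx.apply_eq_smul
  set y := Φ M⁻¹ x with hy
  have hxy : Φ M y = x := by
    rw [hy, ← mul_apply_eq_comp, ← map_mul, hinv', map_one]; rfl
  have hy0 : y ≠ 0 := by
    intro h0
    rw [h0, map_zero] at hxy
    exact hx.2 hxy.symm
  -- With Ax = λx, x = My and M⁻¹B = DM⁻¹: (λ - D)y = M⁻¹(A - B)My. The left side has norm at least
  -- min_i |λ - D_i| ‖y‖.
  have hres : lam • y - Φ (Matrix.diagonal D) y = Φ M⁻¹ (Φ (A - B) (Φ M y)) := by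
    have hBx : Φ M⁻¹ (Φ B x) = Φ (Matrix.diagonal D) y := by
      rw [hB, hy]
      simp only [← mul_apply_eq_comp, ← map_mul, ← mul_assoc, hinv, one_mul]
    rw [hxy, map_sub, _root_.sub_apply, map_sub, hBx, hAx, map_smul]
  have hne : Nonempty (Fin n) := by
    by_contra hemp
    rw [not_nonempty_iff] at hemp
    exact hy0 (Subsingleton.elim _ _)
  obtain ⟨i, hi⟩ := Finite.exists_min fun i => ‖D i - lam‖
  refine ⟨D i, hspec ▸ ⟨i, rfl⟩, ?_⟩
  have hcoord : ∀ j, (lam • y - Φ (Matrix.diagonal D) y) j = (lam - D j) * y j := fun j => by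
    have : (Φ (Matrix.diagonal D) y) j = D j * y j := by
      change (Matrix.diagonal D *ᵥ y.ofLp) j = _
      rw [Matrix.mulVec_diagonal]
    simp [this, sub_mul]
  have hlow : ‖D i - lam‖ * ‖y‖ ≤ ‖lam • y - Φ (Matrix.diagonal D) y‖ := by
    rw [EuclideanSpace.norm_eq, EuclideanSpace.norm_eq,
      ← Real.sqrt_sq (norm_nonneg (D i - lam)), ← Real.sqrt_mul (sq_nonneg _), Finset.mul_sum]
    refine Real.sqrt_le_sqrt (Finset.sum_le_sum fun j _ => ?_)
    rw [hcoord, norm_mul, mul_pow, norm_sub_rev lam]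
    gcongr
    exact hi j
  have hup : ‖lam • y - Φ (Matrix.diagonal D) y‖ ≤
      specNorm M⁻¹ * (specNorm (A - B) * (specNorm M * ‖y‖)) := by
    rw [hres]
    refine (specNorm_mulVec_le _ _).trans (mul_le_mul_of_nonneg_left ?_ (norm_nonneg _))
    refine (specNorm_mulVec_le _ _).trans (mul_le_mul_of_nonneg_left ?_ (norm_nonneg _))
    exact specNorm_mulVec_le _ _
  refine le_of_mul_le_mul_right ((hlow.trans hup).trans_eq ?_) (norm_pos_iff.mpr hy0)
  ring

end RestartedAM

end

/-! ### Runs of the method as cycles, and their confinement near the solution -/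

noncomputable section

namespace RestartedAM

variable {d : ℕ} {g : EuclideanSpace ℝ (Fin d) → EuclideanSpace ℝ (Fin d)}
  {xs : EuclideanSpace ℝ (Fin d)} {ρ κ μ L : ℝ}

theorem residual_eq_neg_hMap (g : EuclideanSpace ℝ (Fin d) → EuclideanSpace ℝ (Fin d))
    (x : EuclideanSpace ℝ (Fin d)) : residual g x = -hMap g x := by
  simp [residual, hMap]

/-- Close to the solution the error is controlled by the residual and conversely. -/
theorem LocalConstants.hMap_bounds (hl : LocalConstants g xs ρ κ μ L)
    {x : EuclideanSpace ℝ (Fin d)} (hx : ‖x - xs‖ ≤ ρ) (hx' : κ * ‖x - xs‖ ≤ μ) :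
    μ / 2 * ‖x - xs‖ ≤ ‖hMap g x‖ ∧ ‖hMap g x‖ ≤ (L + μ) * ‖x - xs‖ := by
  have ht := hl.taylor x (by rwa [mem_closedBall_iff_norm])
  obtain ⟨h1, h2⟩ := hl.jacobian xs (Metric.mem_closedBall_self hl.ρ_pos.le) (x - xs)
  have h3 : 1 / 2 * κ * ‖x - xs‖ ^ 2 ≤ μ / 2 * ‖x - xs‖ := by
    nlinarith [norm_nonneg (x - xs)]
  have h4 := norm_sub_norm_le (fderiv ℝ (hMap g) xs (x - xs)) (hMap g x)
  have h5 := norm_sub_norm_le (hMap g x) (fderiv ℝ (hMap g) xs (x - xs))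
  rw [norm_sub_rev] at h4
  have h6 := mul_nonneg hl.μ_pos.le (norm_nonneg (x - xs))
  constructor <;> linarith

theorem IsCycle.le {ty : AMType}
    {res lin : EuclideanSpace ℝ (Fin d) → EuclideanSpace ℝ (Fin d)}
    {b : ℕ → ℝ} {m : ℕ} {τ η : ℝ} {S T : ℕ → State d} {s n : ℕ}
    (h : IsCycle ty res lin b m τ η S T s n) : n ≤ m := by
  rcases n with _ | n
  · exact Nat.zero_le _
  · have := (h.accept n (Nat.lt_succ_self n)).1
    rwa [add_assoc, (h.m_eq le_rfl).1] at this

/-- The cycle of the restarted AM method at iterations `s, …, s + n`. -/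
def Cycle.ofProcess {ty : AMType} {b : ℕ → ℝ} {m : ℕ} {τ η τ₀ β β' : ℝ} {S T : ℕ → State d}
    {s n : ℕ} (hl : LocalConstants g xs ρ κ μ L) (hb : ∀ j, β ≤ |b j| ∧ |b j| ≤ β')
    (hc : IsCycle ty (residual g) (linResidual g xs) b m τ η S T s n) (hne : (S s).x ≠ xs)
    (hsep : ∀ i, 1 ≤ i → i ≤ n → τ₀ ≤ |1 - (S (s + i)).gamma ty (residual g) (i - 1)|) :
    Cycle ty d m τ η τ₀ β β' μ L n where
  res := residual g
  A := fderiv ℝ (hMap g) xs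
  xs := xs
  κ := κ
  ρ := ρ
  b := b
  s := s
  S := S
  T := T
  κ_pos := hl.κ_pos
  ρ_pos := hl.ρ_pos
  norm_le y := (hl.jacobian xs (Metric.mem_closedBall_self hl.ρ_pos.le) y).2
  le_norm y := (hl.jacobian xs (Metric.mem_closedBall_self hl.ρ_pos.le) y).1
  le_inner y := (hl.symmetricPart xs (Metric.mem_closedBall_self hl.ρ_pos.le) y).1
  taylor x hx := by
    rw [residual_eq_neg_hMap, neg_add_eq_sub, norm_sub_rev]
    exact hl.taylor x (by rwa [mem_closedBall_iff_norm])
  b_bounds := hb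
  isCycle := hc
  start_ne := hne
  gamma_sep := hsep

/-- Every iteration of a nondegenerate run is the end of a `Cycle`. -/
theorem exists_cycle_ofProcess {ty : AMType} {b : ℕ → ℝ} {m : ℕ} {τ η τ₀ β β' : ℝ}
    {x₀ : EuclideanSpace ℝ (Fin d)} {S T : ℕ → State d} {k : ℕ}
    (hg : StandingAssumption g xs) (hl : LocalConstants g xs ρ κ μ L)
    (hb : ∀ j, β ≤ |b j| ∧ |b j| ≤ β')
    (hS : S = process ty g b m τ η x₀) (hT : T = linProcess ty g xs b m τ η x₀)
    (hr : ∀ j ≤ k, residual g (S j).x ≠ 0)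
    (hsep : ∀ j, 1 ≤ j → j ≤ k → 1 ≤ (S j).m →
      τ₀ ≤ |1 - (S j).gamma ty (residual g) ((S j).m - 1)|) {j : ℕ} (hj : j ≤ k) :
    (S j).m ≤ m ∧ j - (S j).m + (S j).m = j ∧
    ∃ c : Cycle ty d m τ η τ₀ β β' μ L (S j).m, c.res = residual g ∧ c.lin = linResidual g xs ∧
      c.xs = xs ∧ c.κ = κ ∧ c.ρ = ρ ∧ c.b = b ∧ c.s = j - (S j).m ∧ c.S = S ∧ c.T = T := by
  obtain ⟨s, hs, hc⟩ := exists_isCycle ty g xs b m τ η x₀ j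
  rw [← hS, ← hT] at hc
  rw [← hS] at hs
  have hsj : s = j - (S j).m := by omega
  -- The residual vanishes at x*, so a nonzero residual at the start of the cycle gives `start_ne`.
  refine ⟨hc.le, by omega, Cycle.ofProcess hl hb hc (fun h => hr s (by omega) ?_) ?_,
    rfl, rfl, rfl, rfl, rfl, rfl, hsj, rfl, rfl⟩
  · rw [h, residual_eq_neg_hMap, hg.root, neg_zero]
  · intro i h1 h2
    have hm := (hc.m_eq h2).1
    have := hsep (s + i) (by omega) (by omega) (by omega)
    rwa [hm] at this

/-- The iterates stay close to the solution. -/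
theorem norm_iterate_sub_le {ty : AMType} {b : ℕ → ℝ} {m : ℕ} {τ η τ₀ η₀ β β' : ℝ}
    {x₀ : EuclideanSpace ℝ (Fin d)} {S T : ℕ → State d} {k : ℕ} {C r R : ℝ}
    (hC : 0 < C)
    (hbounds : ∀ n ≤ m, ∀ c : Cycle ty d m τ η τ₀ β β' μ L n,
      c.eps ≤ r → c.err ≤ r * c.ρ → c.Bounds C)
    (hg : StandingAssumption g xs) (hl : LocalConstants g xs ρ κ μ L)
    (hRκ : κ * R ≤ r) (hRρ : R ≤ r * ρ) (hR : R ≤ ρ) (hR' : κ * R ≤ μ) (hCR : C * R ≤ ρ)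
    (hCR' : κ * (C * R) ≤ μ) (hη₀ : 0 < η₀)
    (hb : ∀ j, β ≤ |b j| ∧ |b j| ≤ β')
    (hx₀ : ‖x₀ - xs‖ ≤ R) (hx₀' : η₀ * ((L + μ) * ‖x₀ - xs‖) ≤ μ / 2 * R)
    (hS : S = process ty g b m τ η x₀) (hT : T = linProcess ty g xs b m τ η x₀)
    (hr : ∀ j ≤ k, residual g (S j).x ≠ 0)
    (hh : ∀ j ≤ k + 1, ‖hMap g (S j).x‖ ≤ η₀ * ‖hMap g x₀‖)
    (hsep : ∀ j, 1 ≤ j → j ≤ k → 1 ≤ (S j).m →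
      τ₀ ≤ |1 - (S j).gamma ty (residual g) ((S j).m - 1)|) {j : ℕ} (hj : j ≤ k + 1) :
    ‖(S j).x - xs‖ ≤ R := by
  -- Strong induction, since the bound is needed at the start of the cycle, m_j steps back. The
  -- estimate C·R for the next iterate would deteriorate if iterated; it only serves to make
  -- `hMap_bounds` applicable there, after which ‖h(x_{j+1})‖ ≤ η₀‖h(x₀)‖ brings the distance back
  -- to R.
  induction j using Nat.strong_induction_on with
  | _ j ih =>
  rcases j with _ | j
  · rw [hS]
    exact hx₀
  · obtain ⟨hm, hjm, c, hres, -, hxs, hκ, hρ, hcb, hs, hcS, -⟩ :=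
      exists_cycle_ofProcess hg hl hb hS hT hr hsep (j := j) (by omega)
    have herr : c.err ≤ R := by
      rw [Cycle.err, hcS, hs, hxs]
      exact ih _ (by omega) (by omega)
    have hB := hbounds _ hm c
      (by rw [Cycle.eps, hκ]; exact (mul_le_mul_of_nonneg_left herr hl.κ_pos.le).trans hRκ)
      (by rw [hρ]; exact herr.trans hRρ)
    have hnext : ‖(S (j + 1)).x - xs‖ ≤ C * R := by
      have h := hB.next_le
      rw [hcS, hs, hxs, hres, hcb, hjm] at h
      rw [hS, process_succ_x, ← hS]
      exact h.trans (mul_le_mul_of_nonneg_left herr hC.le)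
    have h1 := (hl.hMap_bounds (hnext.trans hCR)
      ((mul_le_mul_of_nonneg_left hnext hl.κ_pos.le).trans hCR')).1
    have h2 := (hl.hMap_bounds (hx₀.trans hR)
      ((mul_le_mul_of_nonneg_left hx₀ hl.κ_pos.le).trans hR')).2
    have h3 := mul_le_mul_of_nonneg_left h2 hη₀.le
    have h4 : μ / 2 * ‖(S (j + 1)).x - xs‖ ≤ μ / 2 * R := by linarith [hh (j + 1) hj]
    exact le_of_mul_le_mul_left h4 (half_pos hl.μ_pos)

/-- A radius below which all smallness conditions hold. -/
theorem exists_radius {C r : ℝ} (hr : 0 < r) (hρ : 0 < ρ)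
    (hμ : 0 < μ) : ∃ R > 0, κ * R ≤ r ∧ R ≤ r * ρ ∧ R ≤ ρ ∧ κ * R ≤ μ ∧ C * R ≤ ρ ∧
      κ * (C * R) ≤ μ := by
  have hle : ∀ a b : ℝ, 0 < b → ∀ᶠ R in 𝓝[>] (0 : ℝ), a * R ≤ b := fun a b hb => by
    have h : Filter.Tendsto (fun R : ℝ => a * R) (𝓝 0) (𝓝 (a * 0)) :=
      (continuous_const_mul a).tendsto 0
    rw [mul_zero] at h
    exact (h.mono_left nhdsWithin_le_nhds).eventually_le_const hb
  have hpos : ∀ᶠ R in 𝓝[>] (0 : ℝ), 0 < R := self_mem_nhdsWithin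
  obtain ⟨R, h0, h1, h2, h3, h4, h5, h6⟩ := (hpos.and
    ((hle κ r hr).and ((hle 1 (r * ρ) (mul_pos hr hρ)).and ((hle 1 ρ hρ).and
      ((hle κ μ hμ).and ((hle C ρ hρ).and (hle (κ * C) μ hμ))))))).exists
  rw [one_mul] at h2 h3
  exact ⟨R, h0, h1, h2, h3, h4, h5, by rwa [← mul_assoc]⟩

end RestartedAM

end

/-! ### Choice of constants and conclusion -/

theorem theorem5p1 (ty : RestartedAM.AMType) (d m : ℕ) (τ η η₀ τ₀ β β' μ L : ℝ)
    (hm : 0 < m) (hτ : 0 < τ) (hτ1 : τ < 1) (hη : 0 < η) (hη₀ : 0 < η₀) (hτ₀ : 0 < τ₀)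
    (hβ : 0 < β) (hβ' : 0 < β') :
    ∃ C : ℝ, 0 < C ∧
      ∀ (g : EuclideanSpace ℝ (Fin d) → EuclideanSpace ℝ (Fin d))
        (xs : EuclideanSpace ℝ (Fin d)) (ρ κ : ℝ),
        RestartedAM.StandingAssumption g xs →
        RestartedAM.LocalConstants g xs ρ κ μ L →
        ∃ δ : ℝ, 0 < δ ∧
          ∀ (b : ℕ → ℝ), (∀ j, β ≤ |b j| ∧ |b j| ≤ β') →
          ∀ (x₀ : EuclideanSpace ℝ (Fin d)), ‖x₀ - xs‖ ≤ δ →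
          ∀ (S T : ℕ → RestartedAM.State d),
            S = RestartedAM.process ty g b m τ η x₀ →
            T = RestartedAM.linProcess ty g xs b m τ η x₀ →
          ∀ k n : ℕ, n = (S k).m →
          ∀ H Hhat : Matrix (Fin n) (Fin n) ℝ,
            H = RestartedAM.hess ty (RestartedAM.residual g) b S k n →
            Hhat = RestartedAM.hess ty (RestartedAM.linResidual g xs) b T k n →
            2 ≤ (S (k + 1)).m →
            (∀ j ≤ k, RestartedAM.residual g (S j).x ≠ 0) →
            (∀ j ≤ k + 1, ‖RestartedAM.hMap g (S j).x‖ ≤ η₀ * ‖RestartedAM.hMap g x₀‖) →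
            (∀ j, 1 ≤ j → j ≤ k → 1 ≤ (S j).m →
              τ₀ ≤ |1 - (S j).gamma ty (RestartedAM.residual g) ((S j).m - 1)|) →
            (∀ j ≤ k, (S j).WellPosed ty (RestartedAM.residual g) (b j) ∧
              (T j).WellPosed ty (RestartedAM.linResidual g xs) (b j)) ∧
            ∀ lam ∈ RestartedAM.cSpectrum H,
              (∃ lamHat ∈ RestartedAM.cSpectrum Hhat,
                ‖lamHat - lam‖ ≤ κ ^ (1 / (n : ℝ)) *
                  (C * ‖(S (k - n)).x - xs‖ ^ (1 / (n : ℝ)))) ∧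
              ∀ (M : Matrix (Fin n) (Fin n) ℂ) (D : Fin n → ℂ), IsUnit M.det →
                Hhat.map (fun t : ℝ => (t : ℂ)) = M * Matrix.diagonal D * M⁻¹ →
                ∃ lamHat ∈ RestartedAM.cSpectrum Hhat,
                  ‖lamHat - lam‖ ≤
                    RestartedAM.specNorm M * RestartedAM.specNorm M⁻¹ * κ *
                      (C * ‖(S (k - n)).x - xs‖) := by
  -- For μ ≤ 0 there are no admissible local constants, and the claim is vacuous.
  by_cases hμ : 0 < μ
  swap
  · exact ⟨1, one_pos, fun g xs ρ κ _ hl => absurd hl.μ_pos hμ⟩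
  obtain ⟨C, hC, r, hr, hbounds⟩ := RestartedAM.Cycle.exists_bounds d ty m η β' L hτ hβ hμ hτ₀ m
  choose C₁ hC₁ hpert using fun n => RestartedAM.exists_spectrum_perturbation n C
  choose C₂ hC₂ hspec using RestartedAM.exists_specNorm_le
  -- `D n` serves both eigenvalue bounds when m_k = n. Since C must not depend on k, it is the sum
  -- over all n ≤ m, plus 1 for positivity.
  set D : ℕ → ℝ := fun n => (C₁ n * C) ^ (1 / (n : ℝ)) + C₂ n * C with hD
  have hD₁ : ∀ n, 0 ≤ (C₁ n * C) ^ (1 / (n : ℝ)) := fun n =>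
    Real.rpow_nonneg (mul_nonneg (hC₁ n) hC.le) _
  have hD₂ : ∀ n, 0 ≤ C₂ n * C := fun n => mul_nonneg (hC₂ n) hC.le
  have hD₀ : ∀ n, 0 ≤ D n := fun n => add_nonneg (hD₁ n) (hD₂ n)
  have hDle : ∀ n ≤ m, D n ≤ 1 + ∑ i ∈ Finset.range (m + 1), D i := fun n hn =>
    (Finset.single_le_sum (fun i _ => hD₀ i) (Finset.mem_range.mpr (Nat.lt_succ_of_le hn))).trans
      (le_add_of_nonneg_left zero_le_one)
  refine ⟨1 + ∑ i ∈ Finset.range (m + 1), D i,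
    add_pos_of_pos_of_nonneg one_pos (Finset.sum_nonneg fun i _ => hD₀ i),
    fun g xs ρ κ hg hl => ?_⟩
  obtain ⟨R, hR, hRκ, hRρ, hRle, hR', hCR, hCR'⟩ :=
    RestartedAM.exists_radius (κ := κ) (C := C) hr hl.ρ_pos hμ
  have hLμ : 0 < η₀ * (L + μ) := mul_pos hη₀ (add_pos hl.L_pos hμ)
  -- The second entry ensures η₀‖h(x₀)‖ ≤ η₀(L + μ)‖x₀ - x*‖ ≤ (μ/2)R, which closes the induction
  -- confining the iterates.
  refine ⟨min R (μ / 2 * R / (η₀ * (L + μ))),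
    lt_min hR (div_pos (mul_pos (half_pos hμ) hR) hLμ), ?_⟩
  intro b hb x₀ hx₀ S T hS hT k n hn H Hhat hH hHhat hm2 hres hh hsep
  have hx₀' : η₀ * ((L + μ) * ‖x₀ - xs‖) ≤ μ / 2 * R := by
    have := hx₀.trans (min_le_right _ _)
    rw [le_div_iff₀ hLμ] at this
    linarith
  have hball : ∀ j ≤ k + 1, ‖(S j).x - xs‖ ≤ R := fun j hj =>
    RestartedAM.norm_iterate_sub_le hC hbounds hg hl hRκ hRρ hRle hR' hCR hCR' hη₀ hb
      (hx₀.trans (min_le_left _ _)) hx₀' hS hT hres hh hsep hj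
  have hcyc : ∀ j ≤ k, (S j).m ≤ m ∧ j - (S j).m + (S j).m = j ∧
      ∃ c : RestartedAM.Cycle ty d m τ η τ₀ β β' μ L (S j).m, c.res = RestartedAM.residual g ∧
        c.lin = RestartedAM.linResidual g xs ∧ c.xs = xs ∧ c.κ = κ ∧ c.b = b ∧
        c.s = j - (S j).m ∧ c.S = S ∧ c.T = T ∧ c.Bounds C := by
    intro j hj
    obtain ⟨hm, hjm, c, hres, hlin, hxs, hκ, hρ, hcb, hs, hcS, hcT⟩ :=
      RestartedAM.exists_cycle_ofProcess hg hl hb hS hT hres hsep hj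
    have herr : c.err ≤ R := by
      rw [RestartedAM.Cycle.err, hcS, hs, hxs]
      exact hball _ (by omega)
    exact ⟨hm, hjm, c, hres, hlin, hxs, hκ, hcb, hs, hcS, hcT, hbounds _ hm c
      (by rw [RestartedAM.Cycle.eps, hκ]
          exact (mul_le_mul_of_nonneg_left herr hl.κ_pos.le).trans hRκ)
      (by rw [hρ]; exact herr.trans hRρ)⟩
  refine ⟨fun j hj => ?_, fun lam hlam => ?_⟩
  · obtain ⟨-, hjm, c, hres, hlin, -, -, hcb, hs, hcS, hcT, hB⟩ := hcyc j hj
    have := hB.wellPosed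
    rwa [hres, hlin, hcb, hs, hcS, hcT, hjm] at this
  obtain ⟨hnm, -, c, hres, hlin, hxs, hκ, hcb, hs, hcS, hcT, hB⟩ := hcyc k le_rfl
  rw [← hn] at hnm
  -- m_{k+1} is either 0 or m_k + 1, so m_{k+1} ≥ 2 rules out m_k = 0.
  have hn0 : n ≠ 0 := by
    rintro rfl
    rw [hS, RestartedAM.process] at hm2
    rw [hS] at hn
    split_ifs at hm2
    · rw [RestartedAM.State.extend_m, ← hn] at hm2
      omega
    · exact absurd hm2 (by simp [RestartedAM.State.restart])
  subst hn
  have hHc : ∀ i j, H i j = c.hessI i j := fun i j => by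
    rw [hH, RestartedAM.Cycle.hessI, hres, hcb, hs, hcS]
    rfl
  have hHhatc : ∀ i j, Hhat i j = c.hessII i j := fun i j => by
    rw [hHhat, RestartedAM.Cycle.hessII, hlin, hcb, hs, hcT]
    rfl
  have heps : c.eps = κ * ‖(S (k - (S k).m)).x - xs‖ := by
    rw [RestartedAM.Cycle.eps, RestartedAM.Cycle.err, hκ, hcS, hs, hxs]
  have heps₀ : 0 ≤ c.eps := mul_nonneg c.κ_pos.le c.err_pos.le
  have hsub : ∀ i j, ‖H.map (fun t : ℝ => (t : ℂ)) i j - Hhat.map (fun t : ℝ => (t : ℂ)) i j‖ ≤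
      C * c.eps := fun i j => by
    rw [Matrix.map_apply, Matrix.map_apply, ← Complex.ofReal_sub, Complex.norm_real, hHc, hHhatc]
    exact hB.sub_le i j
  have hCe : 0 ≤ C * c.eps := mul_nonneg hC.le heps₀
  refine ⟨?_, fun M Dg hM hMD => ?_⟩
  · obtain ⟨z, hz, hle⟩ := hpert (S k).m _ _ (C * c.eps) hn0 hCe
      (fun i j => by
        rw [Matrix.map_apply, Complex.norm_real, hHc]
        exact hB.hessI_le i j)
      (fun i j => by
        rw [Matrix.map_apply, Complex.norm_real, hHhatc]
        exact hB.hessII_le i j) hsub lam hlam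
    refine ⟨z, hz, hle.trans ?_⟩
    rw [← mul_assoc, Real.mul_rpow (mul_nonneg (hC₁ _) hC.le) heps₀, heps,
      Real.mul_rpow hl.κ_pos.le (norm_nonneg _), mul_left_comm]
    refine mul_le_mul_of_nonneg_left (mul_le_mul_of_nonneg_right ?_ (by positivity))
      (Real.rpow_nonneg hl.κ_pos.le _)
    exact (le_add_of_nonneg_right (hD₂ _)).trans (hDle _ hnm)
  · obtain ⟨z, hz, hle⟩ := RestartedAM.bauer_fike hM hMD hlam
    refine ⟨z, hz, hle.trans ?_⟩
    have hnorm := hspec (S k).m (H.map (fun t : ℝ => (t : ℂ)) - Hhat.map (fun t : ℝ => (t : ℂ)))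
      (C * c.eps) hCe hsub
    have hMM : 0 ≤ RestartedAM.specNorm M * RestartedAM.specNorm M⁻¹ :=
      mul_nonneg (norm_nonneg _) (norm_nonneg _)
    rw [mul_assoc _ κ]
    refine mul_le_mul_of_nonneg_left (hnorm.trans ?_) hMM
    rw [← mul_assoc, mul_left_comm κ, ← heps]
    exact mul_le_mul_of_nonneg_right ((le_add_of_nonneg_left (hD₁ _)).trans (hDle _ hnm)) heps₀
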